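/- Let $M$ be a von Neumann algebra acting on a complex Hilbert space $H$, let $M'$ be its commutant, and let $P,Q:M\to M$ be normal, unital, completely positive maps; write $PQ=P\circ Q$. Inner products are linear in the second variable. **Notation.** If $K$ is a Hilbert space with a $*$-representation $\pi$ of $M$, then $M\otimes_P K$ is the Hausdorff completion of the algebraic tensor product $M\otimes K$ for $\langle S\otimes h,T\otimes k\rangle=\langle h,\pi(P(S^*T))k\rangle$, on which $M$ acts by $\pi_P(S)(T\otimes k)=ST\otimes k$. This defines $M\otimes_P H$, $M\otimes_Q H$, $M\otimes_{PQ}H$ and $M\otimes_Q M\otimes_P H=M\otimes_Q(M\otimes_P H)$; $M'$ acts on them by $I\otimes R$ and $I\otimes I\otimes R$. For $K$ one of these spaces let $L_M(H,K)$ be the space of bounded $X:H\to K$ with $X T=\pi(T)X$ for all $T\in M$, where $\pi$ denotes the action of $M$ on $K$. It is a correspondence over $M'$: the left action of $R$ is composition with the action of $R$ on $K$, the right action is $X\cdot R=XR$, and $\langle X,Y\rangle=X^*Y$. Put $L_P=L_M(H,M\otimes_P H)$, and similarly $L_Q$, $L_{PQ}$. For $Y\in B(H)$ let $\Phi_Y(S\otimes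 h)=SY^*h$, and let $E_P$ be the space of those $Y$ for which $\Phi_Y$ extends to a bounded operator $\Phi_Y:M\otimes_P H\to H$. It is a correspondence over $M'$ with actions by multiplication in $B(H)$ and $\langle Y,Z\rangle=\Phi_Y\Phi_Z^*$, and $U_P:E_P\to L_P$, $U_P(Y)=\Phi_Y^*$, is an isomorphism of correspondences (a bijective bimodule map preserving inner products). For correspondences $E,F$ over $M'$, $E\otimes F$ denotes the tensor product in the sense of $W^*$-correspondences, i.e. the self-dual completion of the balanced algebraic tensor product with $\langle x\otimes y,x'\otimes y'\rangle=\langle y,\langle x,x'\rangle y'\rangle$. Concretely it is the closure, in the strong operator topology, of the operators $h\mapsto z\otimes h$ ($z$ in the algebraic tensor product) from $H$ to the Hilbert space $E\otimes_{M'}F\otimes_{M'}H$, with $\langle S,T\rangle=S^*T$. For $X\in L_P$ and $Y\in L_Q$ put $\Psi(X\otimes Y)=(I\otimes X)Y$, where $I\otimes X:M\otimes_Q H\to M\otimes_Q M\otimes_P H$ maps $S\otimes h$ to $S\otimes Xh$. Let $V_0:M\otimes_{PQ}H\to M\otimes_Q M\otimes_P H$, $V_0(S\otimes h)=S\otimes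 I\otimes h$, and let $V:L_{PQ}\to L_M(H,M\otimes_Q M\otimes_P H)$, $V(X)=V_0X$, with adjoint $V^*(Z)=V_0^*Z$. Let $M\otimes_Q I\otimes_P H$ be the closed linear span of the vectors $S\otimes I\otimes h$ ($S\in M$, $h\in H$). **Proposition.** 1. There is exactly one isomorphism of correspondences $\Psi:L_P\otimes L_Q\to L_M(H,M\otimes_Q M\otimes_P H)$ with $\Psi(X\otimes Y)=(I\otimes X)Y$ for all $X\in L_P$, $Y\in L_Q$. 2. $V$ is an isometry, $\langle V(X),V(X')\rangle=\langle X,X'\rangle$, and its range is $$\{Z\in L_M(H,M\otimes_Q M\otimes_P H)\mid Z(H)\subseteq M\otimes_Q I\otimes_P H\}.$$ 3. There is exactly one adjointable map $m:E_P\otimes E_Q\to E_{PQ}$ with $m(Y\otimes Z)=YZ$ for all $Y\in E_P$, $Z\in E_Q$, and it satisfies $$U_{PQ}\,m\,(U_P^{-1}\otimes U_Q^{-1})=V^*\Psi .$$ Moreover $m$ is coisometric ($mm^*=I$) and $m^*$ is isometric. -/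

import Mathlib

open scoped TensorProduct InnerProductSpace ComplexOrder

noncomputable section

namespace ArvesonCorr

universe u v w

section Basics

variable {H : Type u} [NormedAddCommGroup H] [InnerProductSpace ℂ H]

/-- Positivity of a finite square matrix of operators on `H`, viewed as an operator on the direct
sum of copies of `H`: `∑ i j, ⟨h i, A i j (h j)⟩ ≥ 0` for all vectors `h`. -/
def MatrixPos {ι : Type} [Fintype ι] (A : ι → ι → (H →L[ℂ] H)) : Prop :=
  ∀ h : ι → H, 0 ≤ ∑ i, ∑ j, ⟪h i, A i j (h j)⟫_ℂ

variable [CompleteSpace H]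

/-- The elements of a von Neumann algebra `M`, as a `*`-algebra. -/
abbrev El (M : VonNeumannAlgebra H) : Type u := ↥M.toStarSubalgebra

instance (M : VonNeumannAlgebra H) : Ring (El M) := inferInstance
instance (M : VonNeumannAlgebra H) : Semiring (El M) := inferInstance
instance (M : VonNeumannAlgebra H) : AddCommGroup (El M) := inferInstance
instance (M : VonNeumannAlgebra H) : AddCommMonoid (El M) := inferInstance
instance (M : VonNeumannAlgebra H) : StarRing (El M) := inferInstance
instance (M : VonNeumannAlgebra H) : Algebra ℂ (El M) := inferInstance
instance (M : VonNeumannAlgebra H) : Module ℂ (El M) := inferInstance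

theorem El.comm {M : VonNeumannAlgebra H} (a : El M) (b : El M.commutant) :
    (a : H →L[ℂ] H) * b = b * a :=
  VonNeumannAlgebra.mem_commutant_iff.1 b.2 a a.2

/-- The positive square root of a positive operator, with its commutation property. -/
theorem exists_sqrt (T : H →L[ℂ] H) (hT : 0 ≤ T) :
    ∃ B : H →L[ℂ] H, B * B = T ∧ IsSelfAdjoint B ∧ ∀ D, Commute T D → Commute B D :=
  ⟨CFC.sqrt T, CFC.sqrt_mul_sqrt_self T hT, (CFC.sqrt_nonneg T).isSelfAdjoint, fun _ hD => by
    unfold CFC.sqrt; exact Commute.cfcₙ_nnreal hD _⟩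

/-- A positive matrix over a von Neumann algebra has a square root over that algebra. -/
theorem exists_gram (N : VonNeumannAlgebra H) {ι : Type} [Fintype ι] (A : ι → ι → El N)
    (hA : MatrixPos fun i j => (A i j : H →L[ℂ] H)) :
    ∃ C : ι → ι → El N, ∀ i j, A i j = ∑ k, star (C k i) * C k j := by
  classical
  let p : ι → (PiLp 2 (fun _ : ι => H) →L[ℂ] H) := fun i => PiLp.proj 2 (fun _ : ι => H) i
  let e : ι → (H →L[ℂ] PiLp 2 (fun _ : ι => H)) := fun i => ContinuousLinearMap.adjoint (p i)
  have he : ∀ i h j, (e i h) j = if j = i then h else 0 := by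
    intro i h j
    refine ext_inner_left ℂ fun v => ?_
    have h1 : ⟪PiLp.single 2 j v, e i h⟫_ℂ = ⟪p i (PiLp.single 2 j v), h⟫_ℂ :=
      ContinuousLinearMap.adjoint_inner_right _ _ _
    have h2 : ⟪PiLp.single 2 j v, e i h⟫_ℂ = ⟪v, (e i h) j⟫_ℂ := by
      rw [PiLp.inner_apply]
      rw [Finset.sum_eq_single j] <;> simp +contextual
    rw [← h2, h1]
    by_cases hij : j = i
    · subst hij; simp [p]
    · simp [p, hij, Ne.symm hij]
  have hpe : ∀ i j h, p i (e j h) = if i = j then h else 0 := fun i j h => he j h i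
  have hsum : ∀ x, ∑ k, e k (p k x) = x := by
    intro x
    ext j
    simp [he, p]
  let T : PiLp 2 (fun _ : ι => H) →L[ℂ] PiLp 2 (fun _ : ι => H) :=
    ∑ i, ∑ j, e i ∘L (A i j : H →L[ℂ] H) ∘L p j
  have hTx : ∀ x y, ⟪x, T y⟫_ℂ = ∑ i, ∑ j, ⟪p i x, (A i j : H →L[ℂ] H) (p j y)⟫_ℂ := by
    intro x y
    simp only [T, _root_.sum_apply, inner_sum, ContinuousLinearMap.comp_apply, e,
      ContinuousLinearMap.adjoint_inner_right]
  have hT0 : ∀ x, 0 ≤ ⟪x, T x⟫_ℂ := fun x => by rw [hTx]; exact hA fun i => p i x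
  have hT : 0 ≤ T := by
    rw [ContinuousLinearMap.nonneg_iff_isPositive, ContinuousLinearMap.isPositive_iff_complex]
    intro x
    have h0 := hT0 x
    have h1 : ⟪T x, x⟫_ℂ = ⟪x, T x⟫_ℂ := by
      rw [← inner_conj_symm]
      exact Complex.conj_eq_iff_im.2 (Complex.nonneg_iff.1 h0).2.symm
    rw [h1]
    have h2 := Complex.nonneg_iff.1 h0
    exact ⟨Complex.ext (by simp) (by simpa using h2.2), h2.1⟩
  obtain ⟨B, hBB, hBs, hBc⟩ := exists_sqrt T hT
  have hcomm : ∀ R : El N.commutant, ∀ i j h,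
      p i (B (e j ((R : H →L[ℂ] H) h))) = (R : H →L[ℂ] H) (p i (B (e j h))) := by
    intro R
    let D : PiLp 2 (fun _ : ι => H) →L[ℂ] PiLp 2 (fun _ : ι => H) :=
      ∑ k, e k ∘L (R : H →L[ℂ] H) ∘L p k
    have hpD : ∀ i x, p i (D x) = (R : H →L[ℂ] H) (p i x) := by
      intro i x
      simp [D, hpe, map_sum]
    have hDe : ∀ j h, D (e j h) = e j ((R : H →L[ℂ] H) h) := by
      intro j h
      simp only [D, _root_.sum_apply, ContinuousLinearMap.comp_apply, hpe]
      rw [Finset.sum_eq_single j] <;> simp +contextual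
    have hDT : Commute T D := by
      ext1 x
      refine ext_inner_left ℂ fun y => ?_
      rw [mul_apply_eq_comp, mul_apply_eq_comp, hTx]
      have : ⟪y, D (T x)⟫_ℂ = ∑ i, ⟪p i y, (R : H →L[ℂ] H) (p i (T x))⟫_ℂ := by
        simp only [D, _root_.sum_apply, inner_sum, ContinuousLinearMap.comp_apply, e,
          ContinuousLinearMap.adjoint_inner_right]
      rw [this]
      refine Finset.sum_congr rfl fun i _ => ?_
      have h3 : p i (T x) = ∑ j, (A i j : H →L[ℂ] H) (p j x) := by
        simp [T, hpe, map_sum]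
      rw [h3, map_sum, inner_sum]
      refine Finset.sum_congr rfl fun j _ => ?_
      rw [hpD]
      have := congrArg (fun S : H →L[ℂ] H => S (p j x)) (El.comm (A i j) R)
      simp only [mul_apply_eq_comp] at this
      rw [this]
    have hDB : Commute B D := hBc D hDT
    intro i j h
    rw [← hDe, ← hpD]
    exact congrArg (p i) (congrArg (fun S : _ →L[ℂ] _ => S (e j h)) hDB.eq)
  have hmem : ∀ i j, p i ∘L B ∘L e j ∈ N := by
    intro i j
    rw [← VonNeumannAlgebra.commutant_commutant N, VonNeumannAlgebra.mem_commutant_iff]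
    intro R hR
    ext h
    exact (hcomm ⟨R, hR⟩ i j h).symm
  refine ⟨fun i j => ⟨p i ∘L B ∘L e j, hmem i j⟩, fun i j => ?_⟩
  apply Subtype.ext
  rw [AddSubmonoidClass.coe_finsetSum]
  ext1 x
  refine ext_inner_left ℂ fun y => ?_
  simp only [_root_.sum_apply, inner_sum, MulMemClass.coe_mul, StarMemClass.coe_star,
    mul_apply_eq_comp, ContinuousLinearMap.star_eq_adjoint,
    ContinuousLinearMap.adjoint_inner_right, ContinuousLinearMap.comp_apply]
  have h1 : ⟪e i y, T (e j x)⟫_ℂ = ⟪y, (A i j : H →L[ℂ] H) x⟫_ℂ := by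
    rw [hTx, Finset.sum_eq_single i, Finset.sum_eq_single j] <;> simp +contextual [hpe]
  have h2 : ⟪e i y, T (e j x)⟫_ℂ = ⟪B (e i y), B (e j x)⟫_ℂ := by
    rw [← hBB, mul_apply_eq_comp, ← ContinuousLinearMap.adjoint_inner_left]
    rw [← ContinuousLinearMap.star_eq_adjoint, hBs.star_eq]
  rw [← h1, h2, PiLp.inner_apply]
  rfl

/-- For `a` in a von Neumann algebra, `‖a‖² - a* a = c* c` for some `c` in it. -/
theorem exists_defect (N : VonNeumannAlgebra H) (a : El N) :
    ∃ c : El N, star a * a + star c * c = ((‖(a : H →L[ℂ] H)‖ ^ 2 : ℝ) : ℂ) • (1 : El N) := by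
  obtain ⟨C, hC⟩ := exists_gram (ι := Unit) N
    (fun _ _ => ((‖(a : H →L[ℂ] H)‖ ^ 2 : ℝ) : ℂ) • (1 : El N) - star a * a) (by
      intro h
      have key : ⟪h (), (((‖(a : H →L[ℂ] H)‖ ^ 2 : ℝ) : ℂ) • (1 : El N) - star a * a : El N).1
          (h ())⟫_ℂ = ((‖(a : H →L[ℂ] H)‖ ^ 2 * ‖h ()‖ ^ 2 - ‖(a : H →L[ℂ] H) (h ())‖ ^ 2 : ℝ) : ℂ)
          := by
        have : (((‖(a : H →L[ℂ] H)‖ ^ 2 : ℝ) : ℂ) • (1 : El N) - star a * a : El N).1 (h ())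
          = ((‖(a : H →L[ℂ] H)‖ ^ 2 : ℝ) : ℂ) • h () - (star (a : H →L[ℂ] H)) (a.1 (h ())) := rfl
        rw [this, inner_sub_right, inner_smul_right, ContinuousLinearMap.star_eq_adjoint,
          ContinuousLinearMap.adjoint_inner_right, inner_self_eq_norm_sq_to_K,
          inner_self_eq_norm_sq_to_K]
        push_cast
        rfl
      simp only [Finset.univ_unique, Finset.sum_singleton]
      change 0 ≤ ⟪h (), _⟫_ℂ
      refine le_of_le_of_eq ?_ key.symm
      rw [Complex.zero_le_real, sub_nonneg, ← mul_pow]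
      gcongr
      exact ContinuousLinearMap.le_opNorm _ _)
  refine ⟨C () (), ?_⟩
  have := hC () ()
  simp only [Finset.univ_unique, Finset.sum_singleton] at this
  change _ = star (C () ()) * C () () at this
  rw [← this]; abel

end Basics

section Kernel

open UniformSpace

/-- A positive definite operator-valued sesquilinear kernel on a vector space `D`, with values in
the bounded operators on `K`. -/
structure PosKernel (D : Type*) (K : Type*) [AddCommGroup D] [Module ℂ D]
    [NormedAddCommGroup K] [InnerProductSpace ℂ K] where
  ker : D →ₗ⋆[ℂ] D →ₗ[ℂ] (K →L[ℂ] K)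
  herm : ∀ d d' k k', ⟪ker d d' k, k'⟫_ℂ = ⟪k, ker d' d k'⟫_ℂ
  pos : ∀ {ι : Type} [Fintype ι] (d : ι → D), MatrixPos fun i j => ker (d i) (d j)

namespace PosKernel

variable {D : Type*} {K : Type*} [AddCommGroup D] [Module ℂ D]
  [NormedAddCommGroup K] [InnerProductSpace ℂ K] (κ : PosKernel D K)

/-- `form (d ⊗ k) (d' ⊗ k') = ⟨k, κ(d, d') k'⟩`. -/
def form : D ⊗[ℂ] K →ₗ⋆[ℂ] D ⊗[ℂ] K →ₗ[ℂ] ℂ :=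
  TensorProduct.lift (LinearMap.mk₂'ₛₗ (starRingEnd ℂ) (starRingEnd ℂ)
    (fun d k => TensorProduct.lift
      (LinearMap.mk₂ ℂ (fun d' k' => ⟪k, κ.ker d d' k'⟫_ℂ)
        (by intros; simp) (by intros; simp) (by intros; simp) (by intros; simp)))
    (by intros; ext; simp) (by intros; ext; simp)
    (by intros; ext; simp) (by intros; ext; simp [mul_comm]))

theorem form_tmul (d d' : D) (k k' : K) :
    κ.form (d ⊗ₜ k) (d' ⊗ₜ k') = ⟪k, κ.ker d d' k'⟫_ℂ := rfl

theorem form_symm (z z' : D ⊗[ℂ] K) : (starRingEnd ℂ) (κ.form z' z) = κ.form z z' := by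
  induction z with
  | zero => simp
  | add a b ha hb => simp [ha, hb]
  | tmul d k =>
    induction z' with
    | zero => simp
    | add a b ha hb => simp [ha, hb]
    | tmul d' k' => rw [form_tmul, form_tmul, inner_conj_symm, κ.herm]

theorem form_sum {ι : Type} [Fintype ι] (d d' : ι → D) (k k' : ι → K) :
    κ.form (∑ i, d i ⊗ₜ k i) (∑ i, d' i ⊗ₜ k' i) =
      ∑ i, ∑ j, ⟪k i, κ.ker (d i) (d' j) (k' j)⟫_ℂ := by
  simp only [map_sum, LinearMap.coe_sum, Finset.sum_apply, form_tmul]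
  exact Finset.sum_comm

theorem form_nonneg (z : D ⊗[ℂ] K) : 0 ≤ κ.form z z := by
  obtain ⟨n, d, k, rfl⟩ := TensorProduct.exists_sum_tmul_eq z
  rw [form_sum]
  exact κ.pos d k

/-- The algebraic tensor product `D ⊗ K`, with the semi-inner product given by the kernel. -/
def Pre (_κ : PosKernel D K) : Type _ := D ⊗[ℂ] K

instance : AddCommGroup κ.Pre := inferInstanceAs (AddCommGroup (D ⊗[ℂ] K))
instance : Module ℂ κ.Pre := inferInstanceAs (Module ℂ (D ⊗[ℂ] K))

/-- The identity map onto the semi-inner product space. -/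
def toPre : D ⊗[ℂ] K ≃ₗ[ℂ] κ.Pre := LinearEquiv.refl ℂ _

/-- The semi-inner product on `D ⊗ K`. -/
abbrev core : PreInnerProductSpace.Core ℂ κ.Pre where
  inner z z' := κ.form (κ.toPre.symm z) (κ.toPre.symm z')
  conj_inner_symm z z' := κ.form_symm _ _
  re_inner_nonneg z := (Complex.nonneg_iff.1 (κ.form_nonneg _)).1
  add_left := by simp
  smul_left := by simp

instance : SeminormedAddCommGroup κ.Pre :=
  InnerProductSpace.Core.toSeminormedAddCommGroup (c := κ.core)
instance : InnerProductSpace ℂ κ.Pre := InnerProductSpace.ofCore κ.core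

theorem inner_toPre (z z' : D ⊗[ℂ] K) : ⟪κ.toPre z, κ.toPre z'⟫_ℂ = κ.form z z' := rfl

theorem norm_sq_toPre (z : D ⊗[ℂ] K) : ((‖κ.toPre z‖ ^ 2 : ℝ) : ℂ) = κ.form z z := by
  rw [← inner_toPre, inner_self_eq_norm_sq_to_K]; simp

/-- The Hausdorff completion of `D ⊗ K` with respect to `⟨d ⊗ k, d' ⊗ k'⟩ = ⟨k, κ(d, d') k'⟩`. -/
def Space : Type _ := Completion κ.Pre

instance : NormedAddCommGroup κ.Space := inferInstanceAs (NormedAddCommGroup (Completion κ.Pre))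
instance : InnerProductSpace ℂ κ.Space := inferInstanceAs (InnerProductSpace ℂ (Completion κ.Pre))
instance : CompleteSpace κ.Space := inferInstanceAs (CompleteSpace (Completion κ.Pre))

instance : NormedSpace ℂ κ.Space := inferInstance
instance : SeminormedAddCommGroup κ.Space := inferInstance
instance : AddCommGroup κ.Space := inferInstance
instance : AddCommMonoid κ.Space := inferInstance
instance : Module ℂ κ.Space := inferInstance
instance : TopologicalSpace κ.Space := inferInstance

/-- The canonical map from the semi-inner product space to its Hausdorff completion. -/
def toSpace : κ.Pre →L[ℂ] κ.Space := (Completion.toComplL (𝕜 := ℂ) (E := κ.Pre))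

/-- The canonical map from the algebraic tensor product to its Hausdorff completion. -/
def of : D ⊗[ℂ] K →ₗ[ℂ] κ.Space := κ.toSpace.toLinearMap ∘ₗ κ.toPre.toLinearMap

theorem inner_of (z z' : D ⊗[ℂ] K) : ⟪κ.of z, κ.of z'⟫_ℂ = κ.form z z' :=
  (Completion.inner_coe (𝕜 := ℂ) (κ.toPre z) (κ.toPre z')).trans (κ.inner_toPre z z')

theorem norm_of (z : D ⊗[ℂ] K) : ‖κ.of z‖ = ‖κ.toPre z‖ :=
  Completion.norm_coe (κ.toPre z)

theorem norm_sq_of (z : D ⊗[ℂ] K) : ((‖κ.of z‖ ^ 2 : ℝ) : ℂ) = κ.form z z := by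
  rw [norm_of, norm_sq_toPre]

theorem norm_sq_of_sum {ι : Type} [Fintype ι] (d : ι → D) (k : ι → K) :
    ((‖κ.of (∑ i, d i ⊗ₜ k i)‖ ^ 2 : ℝ) : ℂ) = ∑ i, ∑ j, ⟪k i, κ.ker (d i) (d j) (k j)⟫_ℂ := by
  rw [norm_sq_of, form_sum]

theorem denseRange_of : DenseRange κ.of :=
  (Completion.denseRange_coe : DenseRange ((↑) : κ.Pre → Completion κ.Pre))

theorem ext_clm {L : Type*} [NormedAddCommGroup L] [NormedSpace ℂ L] {f g : κ.Space →L[ℂ] L}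
    (h : ∀ d k, f (κ.of (d ⊗ₜ k)) = g (κ.of (d ⊗ₜ k))) : f = g := by
  have h1 : f.toLinearMap ∘ₗ κ.of = g.toLinearMap ∘ₗ κ.of := TensorProduct.ext' h
  ext x
  refine κ.denseRange_of.induction_on (p := fun x => f x = g x) x
    (isClosed_eq f.continuous g.continuous) fun z => ?_
  exact congrArg (fun F : _ →ₗ[ℂ] _ => F z) h1

theorem ext_inner' {x y : κ.Space} (h : ∀ d k, ⟪κ.of (d ⊗ₜ k), x⟫_ℂ = ⟪κ.of (d ⊗ₜ k), y⟫_ℂ) :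
    x = y := by
  have : innerSL ℂ x = innerSL ℂ y := by
    apply κ.ext_clm
    intro d k
    rw [innerSL_apply_apply, innerSL_apply_apply, ← inner_conj_symm, h, inner_conj_symm]
  refine ext_inner_right ℂ fun z => ?_
  exact congrArg (fun F : _ →L[ℂ] _ => F z) this

section Lift

variable {L : Type*} [NormedAddCommGroup L] [NormedSpace ℂ L] [CompleteSpace L]

/-- The unique bounded extension to the completion of a bounded linear map on `D ⊗ K`. -/
def lift (f : D ⊗[ℂ] K →ₗ[ℂ] L) (hf : ∃ C : ℝ, ∀ z, ‖f z‖ ≤ C * ‖κ.of z‖) : κ.Space →L[ℂ] L :=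
  let g : κ.Pre →L[ℂ] L := LinearMap.mkContinuousOfExistsBound (f ∘ₗ κ.toPre.symm.toLinearMap)
    (hf.imp fun _ h z => (h (κ.toPre.symm z)).trans_eq (by rw [norm_of]; rfl))
  g.extend κ.toSpace

theorem lift_of (f : D ⊗[ℂ] K →ₗ[ℂ] L) (hf : ∃ C : ℝ, ∀ z, ‖f z‖ ≤ C * ‖κ.of z‖)
    (z : D ⊗[ℂ] K) : κ.lift f hf (κ.of z) = f z :=
  ContinuousLinearMap.extend_eq _ (e := κ.toSpace) κ.denseRange_of
    (Completion.isUniformInducing_coe κ.Pre) _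

end Lift

/-- The bounded operator `k ↦ d ⊗ k`. -/
def creation : D →ₗ[ℂ] (K →L[ℂ] κ.Space) where
  toFun d := LinearMap.mkContinuousOfExistsBound (κ.of ∘ₗ TensorProduct.mk ℂ D K d)
    ⟨√‖κ.ker d d‖, fun k => by
      refine le_of_sq_le_sq ?_ (by positivity)
      have h1 : ((‖κ.of (d ⊗ₜ k)‖ ^ 2 : ℝ) : ℂ) = ⟪k, κ.ker d d k⟫_ℂ := by
        rw [norm_sq_of, form_tmul]
      have h2 : ‖κ.of (d ⊗ₜ k)‖ ^ 2 = ‖⟪k, κ.ker d d k⟫_ℂ‖ := by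
        rw [← h1, Complex.norm_real, Real.norm_of_nonneg (by positivity)]
      rw [mul_pow, Real.sq_sqrt (norm_nonneg _)]
      refine h2.trans_le ((norm_inner_le_norm _ _).trans ?_)
      have := (κ.ker d d).le_opNorm k
      nlinarith [norm_nonneg k]⟩
  map_add' d d' := by ext k; simp
  map_smul' c d := by ext k; simp

theorem creation_apply (d : D) (k : K) : κ.creation d k = κ.of (d ⊗ₜ k) := rfl

theorem inner_creation (d d' : D) (k k' : K) :
    ⟪κ.creation d k, κ.creation d' k'⟫_ℂ = ⟪k, κ.ker d d' k'⟫_ℂ := by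
  rw [creation_apply, creation_apply, inner_of, form_tmul]

end PosKernel

end Kernel

section Dilation

variable {H : Type u} [NormedAddCommGroup H] [InnerProductSpace ℂ H] [CompleteSpace H]

/-- The `σ`-weakly continuous linear functionals on `M`: those of the form
`T ↦ ∑ n, ⟨a n, T (b n)⟩` with `∑ ‖a n‖²` and `∑ ‖b n‖²` finite. -/
def IsSigmaWeak (M : VonNeumannAlgebra H) (f : El M →ₗ[ℂ] ℂ) : Prop :=
  ∃ a b : ℕ → H, (Summable fun n => ‖a n‖ ^ 2) ∧ (Summable fun n => ‖b n‖ ^ 2) ∧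
    ∀ T : El M, HasSum (fun n => ⟪a n, (T : H →L[ℂ] H) (b n)⟫_ℂ) (f T)

/-- Normal (that is, `σ`-weakly continuous), unital, completely positive maps `M → M`. -/
structure NormalUCP (M : VonNeumannAlgebra H) where
  map : El M →ₗ[ℂ] El M
  map_one : map 1 = 1
  /-- For every `n`, the entrywise map on `n × n` matrices over `M` preserves positivity. -/
  cp : ∀ (n : ℕ) (A : Fin n → Fin n → El M), MatrixPos (fun i j => (A i j : H →L[ℂ] H)) →
    MatrixPos (fun i j => (map (A i j) : H →L[ℂ] H))
  /-- Composition with the map preserves `σ`-weak continuity of functionals. -/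
  normal : ∀ f : El M →ₗ[ℂ] ℂ, IsSigmaWeak M f → IsSigmaWeak M (f ∘ₗ map)

namespace NormalUCP

variable {M : VonNeumannAlgebra H}

/-- The composition `P ∘ Q`. -/
def comp (P Q : NormalUCP M) : NormalUCP M where
  map := P.map ∘ₗ Q.map
  map_one := by simp [Q.map_one, P.map_one]
  cp n A hA := P.cp n _ (Q.cp n A hA)
  normal f hf := Q.normal _ (P.normal f hf)

theorem cp' (P : NormalUCP M) {ι : Type} [Fintype ι] (A : ι → ι → El M)
    (hA : MatrixPos fun i j => (A i j : H →L[ℂ] H)) :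
    MatrixPos fun i j => (P.map (A i j) : H →L[ℂ] H) := by
  intro h
  let e := Fintype.equivFin ι
  have h1 := P.cp (Fintype.card ι) (fun i j => A (e.symm i) (e.symm j)) (by
    intro g
    have := hA fun i => g (e i)
    rw [← e.symm.sum_comp] at this
    simp_rw [← e.symm.sum_comp (g := fun j => ⟪_, (A _ j : H →L[ℂ] H) (g (e j))⟫_ℂ)] at this
    simpa using this) fun i => h (e.symm i)
  rw [← e.symm.sum_comp]
  simp_rw [← e.symm.sum_comp (g := fun j => ⟪_, (P.map (A _ j) : H →L[ℂ] H) (h j)⟫_ℂ)]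
  exact h1

theorem matrixPos_gram {ι : Type} [Fintype ι] (T : ι → El M) :
    MatrixPos fun i j => ((star (T i) * T j : El M) : H →L[ℂ] H) := by
  intro h
  have : ∑ i, ∑ j, ⟪h i, ((star (T i) * T j : El M) : H →L[ℂ] H) (h j)⟫_ℂ =
      ⟪∑ i, (T i : H →L[ℂ] H) (h i), ∑ i, (T i : H →L[ℂ] H) (h i)⟫_ℂ := by
    simp only [sum_inner, inner_sum, MulMemClass.coe_mul, StarMemClass.coe_star,
      mul_apply_eq_comp, ContinuousLinearMap.star_eq_adjoint,
      ContinuousLinearMap.adjoint_inner_right]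
    exact Finset.sum_comm
  have h2 : ⟪∑ i, (T i : H →L[ℂ] H) (h i), ∑ i, (T i : H →L[ℂ] H) (h i)⟫_ℂ =
      ((‖∑ i, (T i : H →L[ℂ] H) (h i)‖ ^ 2 : ℝ) : ℂ) := by
    rw [inner_self_eq_norm_sq_to_K]; simp
  rw [this, h2, Complex.zero_le_real]
  positivity

theorem exists_cp_gram (P : NormalUCP M) {ι : Type} [Fintype ι] (T : ι → El M) :
    ∃ C : ι → ι → El M, ∀ i j, P.map (star (T i) * T j) = ∑ k, star (C k i) * C k j :=
  exists_gram M _ (P.cp' _ (matrixPos_gram T))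

theorem star_map_gram (P : NormalUCP M) (S T : El M) :
    star (P.map (star S * T)) = P.map (star T * S) := by
  obtain ⟨C, hC⟩ := P.exists_cp_gram (ι := Bool) fun b => if b then S else T
  have h1 := hC true false
  have h2 := hC false true
  simp only [if_true, Bool.false_eq_true, if_false] at h1 h2
  rw [h1, h2, star_sum]
  simp

end NormalUCP

theorem gram_sum {A : Type*} [Ring A] [StarRing A] [Algebra ℂ A]
    {K : Type*} [NormedAddCommGroup K] [InnerProductSpace ℂ K] [CompleteSpace K]
    (ρ : A →⋆ₐ[ℂ] (K →L[ℂ] K)) {ι : Type} [Fintype ι] (C : ι → ι → A) (k : ι → K) :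
    ∑ i, ∑ j, ⟪k i, ρ (∑ l, star (C l i) * C l j) (k j)⟫_ℂ =
      ((∑ l, ‖∑ i, ρ (C l i) (k i)‖ ^ 2 : ℝ) : ℂ) := by
  have : ∀ l, ((‖∑ i, ρ (C l i) (k i)‖ ^ 2 : ℝ) : ℂ) =
      ∑ i, ∑ j, ⟪k i, ρ (star (C l i) * C l j) (k j)⟫_ℂ := by
    intro l
    have h1 : ((‖∑ i, ρ (C l i) (k i)‖ ^ 2 : ℝ) : ℂ) =
        ⟪∑ i, ρ (C l i) (k i), ∑ i, ρ (C l i) (k i)⟫_ℂ := by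
      rw [inner_self_eq_norm_sq_to_K]; simp
    rw [h1]
    simp only [sum_inner, inner_sum, map_mul, map_star, mul_apply_eq_comp,
      ContinuousLinearMap.star_eq_adjoint, ContinuousLinearMap.adjoint_inner_right]
    exact Finset.sum_comm
  rw [Complex.ofReal_sum]
  simp_rw [this, map_sum, _root_.sum_apply, inner_sum]
  rw [Finset.sum_comm' (s := Finset.univ) (t := fun _ => Finset.univ) (t' := Finset.univ)
    (s' := fun _ => Finset.univ) (by simp)]
  rw [Finset.sum_comm]
  refine (Finset.sum_congr rfl fun i _ => Finset.sum_comm).trans ?_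
  rw [Finset.sum_comm]

/-- A Hilbert space `K` with commuting unital `*`-representations of `M` and of the commutant of
`M`. -/
structure BiRep (M : VonNeumannAlgebra H) (K : Type*) [NormedAddCommGroup K]
    [InnerProductSpace ℂ K] [CompleteSpace K] where
  left : El M →⋆ₐ[ℂ] (K →L[ℂ] K)
  right : El M.commutant →⋆ₐ[ℂ] (K →L[ℂ] K)
  comm : ∀ S R, left S * right R = right R * left S

/-- The space `H` itself, with the identity representations. -/
def stdRep (M : VonNeumannAlgebra H) : BiRep M H where
  left := M.toStarSubalgebra.subtype
  right := M.commutant.toStarSubalgebra.subtype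
  comm := El.comm

variable {M : VonNeumannAlgebra H}
variable {K : Type v} [NormedAddCommGroup K] [InnerProductSpace ℂ K] [CompleteSpace K]
variable {K' : Type w} [NormedAddCommGroup K'] [InnerProductSpace ℂ K'] [CompleteSpace K']

/-- The bounded operators `K → K'` that intertwine the actions of `M`. -/
def Intertwines (ρ : BiRep M K) (ρ' : BiRep M K') (X : K →L[ℂ] K') : Prop :=
  ∀ S : El M, X ∘L ρ.left S = ρ'.left S ∘L X

theorem Intertwines.apply {ρ : BiRep M K} {ρ' : BiRep M K'} {X : K →L[ℂ] K'}
    (hX : Intertwines ρ ρ' X) (S : El M) (k : K) : X (ρ.left S k) = ρ'.left S (X k) :=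
  congrArg (fun F : _ →L[ℂ] _ => F k) (hX S)

theorem BiRep.intertwines_right (ρ : BiRep M K) (R : El M.commutant) :
    Intertwines ρ ρ (ρ.right R) := fun S => (ρ.comm S R).symm

theorem Intertwines.adjoint {ρ : BiRep M K} {ρ' : BiRep M K'} {X : K →L[ℂ] K'}
    (hX : Intertwines ρ ρ' X) : Intertwines ρ' ρ (ContinuousLinearMap.adjoint X) := by
  intro S
  have := congrArg ContinuousLinearMap.adjoint (hX (star S))
  simpa only [ContinuousLinearMap.adjoint_comp, map_star, ContinuousLinearMap.star_eq_adjoint,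
    ContinuousLinearMap.adjoint_adjoint] using this.symm

theorem Intertwines.comp {L : Type*} [NormedAddCommGroup L] [InnerProductSpace ℂ L]
    [CompleteSpace L] {σ : BiRep M L} {ρ : BiRep M K} {ρ' : BiRep M K'}
    {X : K →L[ℂ] K'} {Y : L →L[ℂ] K}
    (hX : Intertwines ρ ρ' X) (hY : Intertwines σ ρ Y) : Intertwines σ ρ' (X ∘L Y) := by
  intro S
  rw [ContinuousLinearMap.comp_assoc, hY S, ← ContinuousLinearMap.comp_assoc, hX S,
    ContinuousLinearMap.comp_assoc]

namespace NormalUCP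

/-- The kernel `(S, T) ↦ P(S* T)`, acting on `K` through the representation of `M`. -/
def kernel (P : NormalUCP M) (ρ : BiRep M K) : PosKernel (El M) K where
  ker := LinearMap.mk₂'ₛₗ (starRingEnd ℂ) (RingHom.id ℂ)
    (fun S T => ρ.left (P.map (star S * T)))
    (by intros; simp [add_mul]) (by intros; simp)
    (by intros; simp [mul_add]) (by intros; simp)
  herm S T k k' := by
    simp only [LinearMap.mk₂'ₛₗ_apply]
    rw [← P.star_map_gram S T, map_star, ContinuousLinearMap.star_eq_adjoint,
      ContinuousLinearMap.adjoint_inner_right]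
  pos T k := by
    obtain ⟨C, hC⟩ := P.exists_cp_gram T
    simp only [LinearMap.mk₂'ₛₗ_apply, hC]
    rw [gram_sum, Complex.zero_le_real]
    positivity

theorem kernel_apply (P : NormalUCP M) (ρ : BiRep M K) (S T : El M) :
    (P.kernel ρ).ker S T = ρ.left (P.map (star S * T)) := rfl

/-- The Hilbert space `M ⊗_P K`: the Hausdorff completion of `M ⊗ K` with respect to
`⟨S ⊗ h, T ⊗ k⟩ = ⟨h, P(S* T) k⟩`. -/
abbrev Dil (P : NormalUCP M) (ρ : BiRep M K) : Type _ := (P.kernel ρ).Space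

/-- The element `S ⊗ k` of `M ⊗_P K`. -/
def elem (P : NormalUCP M) (ρ : BiRep M K) (S : El M) (k : K) : P.Dil ρ :=
  (P.kernel ρ).of (S ⊗ₜ[ℂ] k)

theorem inner_elem (P : NormalUCP M) (ρ : BiRep M K) (S T : El M) (h k : K) :
    ⟪P.elem ρ S h, P.elem ρ T k⟫_ℂ = ⟪h, ρ.left (P.map (star S * T)) k⟫_ℂ := by
  rw [elem, elem, PosKernel.inner_of, PosKernel.form_tmul, kernel_apply]

theorem ext_elem (P : NormalUCP M) (ρ : BiRep M K) {L : Type*} [NormedAddCommGroup L]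
    [NormedSpace ℂ L] {f g : P.Dil ρ →L[ℂ] L}
    (h : ∀ S k, f (P.elem ρ S k) = g (P.elem ρ S k)) : f = g :=
  PosKernel.ext_clm _ h

theorem ext_inner_elem (P : NormalUCP M) (ρ : BiRep M K) {x y : P.Dil ρ}
    (h : ∀ S k, ⟪P.elem ρ S k, x⟫_ℂ = ⟪P.elem ρ S k, y⟫_ℂ) : x = y :=
  PosKernel.ext_inner' _ h

/-- For an intertwiner `X : K → K'`, the operator `I ⊗ X : M ⊗_P K → M ⊗_P K'`,
`S ⊗ k ↦ S ⊗ X k`. -/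
def idTensor (P : NormalUCP M) (ρ : BiRep M K) (ρ' : BiRep M K') (X : K →L[ℂ] K')
    (hX : Intertwines ρ ρ' X) : P.Dil ρ →L[ℂ] P.Dil ρ' :=
  (P.kernel ρ).lift ((P.kernel ρ').of ∘ₗ TensorProduct.map LinearMap.id X.toLinearMap) (by
    refine ⟨‖X‖, fun z => ?_⟩
    obtain ⟨n, T, k, rfl⟩ := TensorProduct.exists_sum_tmul_eq z
    obtain ⟨C, hC⟩ := P.exists_cp_gram T
    refine le_of_sq_le_sq ?_ (by positivity)
    have h1 : ‖(P.kernel ρ).of (∑ i, T i ⊗ₜ[ℂ] k i)‖ ^ 2 =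
        ∑ l, ‖∑ i, ρ.left (C l i) (k i)‖ ^ 2 := by
      have := (P.kernel ρ).norm_sq_of_sum T k
      simp only [kernel_apply, hC] at this
      rw [gram_sum] at this
      exact_mod_cast this
    have h2 : ‖(P.kernel ρ').of (∑ i, T i ⊗ₜ[ℂ] X (k i))‖ ^ 2 =
        ∑ l, ‖∑ i, ρ'.left (C l i) (X (k i))‖ ^ 2 := by
      have := (P.kernel ρ').norm_sq_of_sum T fun i => X (k i)
      simp only [kernel_apply, hC] at this
      rw [gram_sum] at this
      exact_mod_cast this
    have h3 : ((P.kernel ρ').of ∘ₗ TensorProduct.map LinearMap.id X.toLinearMap)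
        (∑ i, T i ⊗ₜ[ℂ] k i) = (P.kernel ρ').of (∑ i, T i ⊗ₜ[ℂ] X (k i)) := by
      simp [map_sum]
    rw [h3, mul_pow, h1, h2, Finset.mul_sum]
    refine Finset.sum_le_sum fun l _ => ?_
    have h4 : ∑ i, ρ'.left (C l i) (X (k i)) = X (∑ i, ρ.left (C l i) (k i)) := by
      rw [map_sum]
      exact Finset.sum_congr rfl fun i _ => (hX.apply _ _).symm
    rw [h4, ← mul_pow]
    gcongr
    exact X.le_opNorm _)

theorem idTensor_elem (P : NormalUCP M) (ρ : BiRep M K) (ρ' : BiRep M K') (X : K →L[ℂ] K')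
    (hX : Intertwines ρ ρ' X) (S : El M) (k : K) :
    P.idTensor ρ ρ' X hX (P.elem ρ S k) = P.elem ρ' S (X k) :=
  PosKernel.lift_of _ _ _ _

/-- Left multiplication `T ⊗ k ↦ S T ⊗ k` on `M ⊗_P K`. -/
def leftMul (P : NormalUCP M) (ρ : BiRep M K) (S : El M) : P.Dil ρ →L[ℂ] P.Dil ρ :=
  (P.kernel ρ).lift ((P.kernel ρ).of ∘ₗ TensorProduct.map (LinearMap.mulLeft ℂ S) LinearMap.id) (by
    refine ⟨‖(S : H →L[ℂ] H)‖, fun z => ?_⟩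
    obtain ⟨n, T, k, rfl⟩ := TensorProduct.exists_sum_tmul_eq z
    obtain ⟨c, hc⟩ := exists_defect M S
    have h0 : ∀ a : El M, ((P.kernel ρ).of ∘ₗ
        TensorProduct.map (LinearMap.mulLeft ℂ a) LinearMap.id) (∑ i, T i ⊗ₜ[ℂ] k i) =
        (P.kernel ρ).of (∑ i, (a * T i) ⊗ₜ[ℂ] k i) := fun a => by simp [map_sum]
    refine le_of_sq_le_sq ?_ (by positivity)
    rw [h0, mul_pow]
    have h1 := (P.kernel ρ).norm_sq_of_sum T k
    have h2 := (P.kernel ρ).norm_sq_of_sum (fun i => S * T i) k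
    have h3 := (P.kernel ρ).norm_sq_of_sum (fun i => c * T i) k
    simp only [kernel_apply] at h1 h2 h3
    have h4 : ((‖(P.kernel ρ).of (∑ i, (S * T i) ⊗ₜ[ℂ] k i)‖ ^ 2 : ℝ) : ℂ) +
        ((‖(P.kernel ρ).of (∑ i, (c * T i) ⊗ₜ[ℂ] k i)‖ ^ 2 : ℝ) : ℂ) =
        ((‖(S : H →L[ℂ] H)‖ ^ 2 : ℝ) : ℂ) *
          ((‖(P.kernel ρ).of (∑ i, T i ⊗ₜ[ℂ] k i)‖ ^ 2 : ℝ) : ℂ) := by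
      rw [h1, h2, h3, ← Finset.sum_add_distrib, Finset.mul_sum]
      refine Finset.sum_congr rfl fun i _ => ?_
      rw [← Finset.sum_add_distrib, Finset.mul_sum]
      refine Finset.sum_congr rfl fun j _ => ?_
      have h5 : star (S * T i) * (S * T j) + star (c * T i) * (c * T j) =
          ((‖(S : H →L[ℂ] H)‖ ^ 2 : ℝ) : ℂ) • (star (T i) * T j) := by
        have : star (S * T i) * (S * T j) + star (c * T i) * (c * T j) =
          star (T i) * (star S * S + star c * c) * T j := by
          rw [star_mul, star_mul]; noncomm_ring
        rw [this, hc]; simp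
      rw [← inner_add_right, ← _root_.add_apply, ← map_add, ← map_add, h5, map_smul, map_smul]
      exact inner_smul_right _ _ _
    have h5 : ‖(P.kernel ρ).of (∑ i, (S * T i) ⊗ₜ[ℂ] k i)‖ ^ 2 +
        ‖(P.kernel ρ).of (∑ i, (c * T i) ⊗ₜ[ℂ] k i)‖ ^ 2 =
        ‖(S : H →L[ℂ] H)‖ ^ 2 * ‖(P.kernel ρ).of (∑ i, T i ⊗ₜ[ℂ] k i)‖ ^ 2 := by
      exact_mod_cast h4
    exact (le_add_of_nonneg_right (sq_nonneg _)).trans_eq h5)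

theorem leftMul_elem (P : NormalUCP M) (ρ : BiRep M K) (S T : El M) (k : K) :
    P.leftMul ρ S (P.elem ρ T k) = P.elem ρ (S * T) k :=
  PosKernel.lift_of _ _ _ _

theorem elem_add_left (P : NormalUCP M) (ρ : BiRep M K) (S T : El M) (k : K) :
    P.elem ρ (S + T) k = P.elem ρ S k + P.elem ρ T k := by
  simp [elem, TensorProduct.add_tmul]

theorem elem_smul_left (P : NormalUCP M) (ρ : BiRep M K) (c : ℂ) (S : El M) (k : K) :
    P.elem ρ (c • S) k = c • P.elem ρ S k := by
  simp [elem, ← TensorProduct.smul_tmul']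

theorem elem_add_right (P : NormalUCP M) (ρ : BiRep M K) (S : El M) (h k : K) :
    P.elem ρ S (h + k) = P.elem ρ S h + P.elem ρ S k := by
  simp [elem, TensorProduct.tmul_add]

theorem elem_smul_right (P : NormalUCP M) (ρ : BiRep M K) (c : ℂ) (S : El M) (k : K) :
    P.elem ρ S (c • k) = c • P.elem ρ S k := by
  simp [elem]

/-- The representation `S ↦ (T ⊗ k ↦ S T ⊗ k)` of `M` on `M ⊗_P K`. -/
def dilLeft (P : NormalUCP M) (ρ : BiRep M K) : El M →⋆ₐ[ℂ] (P.Dil ρ →L[ℂ] P.Dil ρ) where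
  toFun := P.leftMul ρ
  map_one' := P.ext_elem ρ fun T k => by rw [leftMul_elem, one_mul]; rfl
  map_mul' := fun a b => P.ext_elem ρ fun T k => by
    rw [mul_apply_eq_comp, leftMul_elem, leftMul_elem, leftMul_elem, mul_assoc]
  map_zero' := P.ext_elem ρ fun T k => by rw [leftMul_elem, zero_mul]; simp [elem]
  map_add' := fun a b => P.ext_elem ρ fun T k => by
    rw [_root_.add_apply, leftMul_elem, leftMul_elem, leftMul_elem, add_mul, elem_add_left]
  commutes' := fun c => P.ext_elem ρ fun T k => by
    rw [leftMul_elem, Algebra.algebraMap_eq_smul_one, smul_mul_assoc, one_mul, elem_smul_left,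
      Algebra.algebraMap_eq_smul_one]; rfl
  map_star' := fun a => P.ext_elem ρ fun T k => P.ext_inner_elem ρ fun S h => by
    rw [ContinuousLinearMap.star_eq_adjoint, ContinuousLinearMap.adjoint_inner_right,
      leftMul_elem, leftMul_elem, inner_elem, inner_elem, star_mul, mul_assoc]

/-- The representation `R ↦ I ⊗ R` of the commutant of `M` on `M ⊗_P K`. -/
def dilRight (P : NormalUCP M) (ρ : BiRep M K) :
    El M.commutant →⋆ₐ[ℂ] (P.Dil ρ →L[ℂ] P.Dil ρ) where
  toFun := fun R => P.idTensor ρ ρ (ρ.right R) (ρ.intertwines_right R)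
  map_one' := P.ext_elem ρ fun T k => by rw [idTensor_elem, _root_.map_one]; rfl
  map_mul' := fun a b => P.ext_elem ρ fun T k => by
    rw [mul_apply_eq_comp, idTensor_elem, idTensor_elem, idTensor_elem, map_mul]; rfl
  map_zero' := P.ext_elem ρ fun T k => by rw [idTensor_elem, map_zero]; simp [elem]
  map_add' := fun a b => P.ext_elem ρ fun T k => by
    rw [_root_.add_apply, idTensor_elem, idTensor_elem, idTensor_elem, map_add,
      _root_.add_apply, elem_add_right]
  commutes' := fun c => P.ext_elem ρ fun T k => by
    rw [idTensor_elem, Algebra.algebraMap_eq_smul_one, map_smul, _root_.map_one,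
      Algebra.algebraMap_eq_smul_one]
    exact elem_smul_right _ _ _ _ _
  map_star' := fun a => P.ext_elem ρ fun T k => P.ext_inner_elem ρ fun S h => by
    rw [ContinuousLinearMap.star_eq_adjoint, ContinuousLinearMap.adjoint_inner_right,
      idTensor_elem, idTensor_elem, inner_elem, inner_elem, map_star,
      ContinuousLinearMap.star_eq_adjoint, ← (ρ.intertwines_right a).adjoint.apply,
      ContinuousLinearMap.adjoint_inner_right]

theorem dilLeft_elem (P : NormalUCP M) (ρ : BiRep M K) (S T : El M) (k : K) :
    P.dilLeft ρ S (P.elem ρ T k) = P.elem ρ (S * T) k := P.leftMul_elem ρ S T k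

theorem dilRight_elem (P : NormalUCP M) (ρ : BiRep M K) (R : El M.commutant) (T : El M) (k : K) :
    P.dilRight ρ R (P.elem ρ T k) = P.elem ρ T (ρ.right R k) :=
  P.idTensor_elem ρ ρ _ (ρ.intertwines_right R) T k

/-- `M ⊗_P K` with its commuting representations of `M` and of the commutant of `M`. -/
def dil (P : NormalUCP M) (ρ : BiRep M K) : BiRep M (P.Dil ρ) where
  left := P.dilLeft ρ
  right := P.dilRight ρ
  comm S R := P.ext_elem ρ fun T k => by
    rw [mul_apply_eq_comp, mul_apply_eq_comp, dilRight_elem, dilLeft_elem, dilLeft_elem,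
      dilRight_elem]

theorem dil_left_elem (P : NormalUCP M) (ρ : BiRep M K) (S T : El M) (k : K) :
    (P.dil ρ).left S (P.elem ρ T k) = P.elem ρ (S * T) k := P.dilLeft_elem ρ S T k

theorem dil_right_elem (P : NormalUCP M) (ρ : BiRep M K) (R : El M.commutant) (T : El M) (k : K) :
    (P.dil ρ).right R (P.elem ρ T k) = P.elem ρ T (ρ.right R k) :=
  P.dilRight_elem ρ R T k

theorem idTensor_intertwines (P : NormalUCP M) (ρ : BiRep M K) (ρ' : BiRep M K') (X : K →L[ℂ] K')
    (hX : Intertwines ρ ρ' X) : Intertwines (P.dil ρ) (P.dil ρ') (P.idTensor ρ ρ' X hX) :=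
  fun S => P.ext_elem ρ fun T k => by
    rw [ContinuousLinearMap.comp_apply, ContinuousLinearMap.comp_apply, dil_left_elem,
      idTensor_elem, idTensor_elem, dil_left_elem]

end NormalUCP

end Dilation

section Corr

variable {H : Type u} [NormedAddCommGroup H] [InnerProductSpace ℂ H] [CompleteSpace H]

/-- A `C*`-correspondence over a von Neumann algebra `N`: a right Hilbert `C*`-module over `N`
(inner product linear in the second variable), with a left action of `N` by adjointable operators.
Positivity of the inner product is recorded for all Gram matrices. -/
class Correspondence (N : VonNeumannAlgebra H) (E : Type*) [AddCommGroup E] [Module ℂ E] where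
  lact : El N →ₐ[ℂ] Module.End ℂ E
  ract : (El N)ᵐᵒᵖ →ₐ[ℂ] Module.End ℂ E
  inner : E →ₗ⋆[ℂ] E →ₗ[ℂ] El N
  lact_ract : ∀ a b x, lact a (ract b x) = ract b (lact a x)
  star_inner : ∀ x y, star (inner x y) = inner y x
  inner_ract : ∀ x y a, inner x (ract (MulOpposite.op a) y) = inner x y * a
  inner_lact : ∀ a x y, inner (lact a x) y = inner x (lact (star a) y)
  inner_pos : ∀ {ι : Type} [Fintype ι] (x : ι → E),
    MatrixPos fun i j => (inner (x i) (x j) : H →L[ℂ] H)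
  inner_definite : ∀ x, inner x x = 0 → x = 0
  /-- Completeness for the norm `‖x‖ = ‖⟨x, x⟩‖^(1/2)`. -/
  complete : ∀ s : ℕ → E,
    (∀ ε > 0, ∃ n₀, ∀ m ≥ n₀, ∀ n ≥ n₀, ‖(inner (s m - s n) (s m - s n) : H →L[ℂ] H)‖ < ε) →
    ∃ x, ∀ ε > 0, ∃ n₀, ∀ n ≥ n₀, ‖(inner (s n - x) (s n - x) : H →L[ℂ] H)‖ < ε

/-- Isomorphisms of correspondences: bijective bimodule maps that preserve inner products. -/
structure CorrIso (N : VonNeumannAlgebra H) (E F : Type*) [AddCommGroup E] [Module ℂ E]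
    [AddCommGroup F] [Module ℂ F] [Correspondence N E] [Correspondence N F]
    extends E ≃ₗ[ℂ] F where
  map_lact : ∀ (a : El N) (x : E),
    toLinearEquiv (Correspondence.lact a x) = Correspondence.lact a (toLinearEquiv x)
  map_ract : ∀ (a : (El N)ᵐᵒᵖ) (x : E),
    toLinearEquiv (Correspondence.ract a x) = Correspondence.ract a (toLinearEquiv x)
  map_inner : ∀ x y : E,
    Correspondence.inner (N := N) (toLinearEquiv x) (toLinearEquiv y) = Correspondence.inner x y

/-- Adjointable maps between correspondences, together with their adjoints. -/
structure AdjMap (N : VonNeumannAlgebra H) (E F : Type*) [AddCommGroup E] [Module ℂ E]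
    [AddCommGroup F] [Module ℂ F] [Correspondence N E] [Correspondence N F] where
  map : E →ₗ[ℂ] F
  adj : F →ₗ[ℂ] E
  map_inner : ∀ (x : E) (y : F),
    Correspondence.inner (N := N) (map x) y = Correspondence.inner x (adj y)

namespace CorrIso

variable {N : VonNeumannAlgebra H} {E F : Type*} [AddCommGroup E] [Module ℂ E]
    [AddCommGroup F] [Module ℂ F] [Correspondence N E] [Correspondence N F]

/-- The inverse isomorphism. -/
def symm (u : CorrIso N E F) : CorrIso N F E where
  toLinearEquiv := u.toLinearEquiv.symm
  map_lact a x := by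
    rw [LinearEquiv.symm_apply_eq, u.map_lact, LinearEquiv.apply_symm_apply]
  map_ract a x := by
    rw [LinearEquiv.symm_apply_eq, u.map_ract, LinearEquiv.apply_symm_apply]
  map_inner x y := by
    rw [← u.map_inner, LinearEquiv.apply_symm_apply, LinearEquiv.apply_symm_apply]

end CorrIso

section Operator

variable {K : Type v} [NormedAddCommGroup K] [InnerProductSpace ℂ K] [CompleteSpace K]

theorem operator_complete (Y : Submodule ℂ (H →L[ℂ] K)) (hc : IsClosed (Y : Set (H →L[ℂ] K)))
    (s : ℕ → Y) (hs : ∀ ε > 0, ∃ n₀, ∀ m ≥ n₀, ∀ n ≥ n₀,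
      ‖ContinuousLinearMap.adjoint (s m - s n).1 ∘L (s m - s n).1‖ < ε) :
    ∃ x : Y, ∀ ε > 0, ∃ n₀, ∀ n ≥ n₀,
      ‖ContinuousLinearMap.adjoint (s n - x).1 ∘L (s n - x).1‖ < ε := by
  have hn : ∀ X : H →L[ℂ] K, ‖ContinuousLinearMap.adjoint X ∘L X‖ = ‖X‖ * ‖X‖ := fun X =>
    ContinuousLinearMap.norm_adjoint_comp_self X
  simp only [hn] at hs ⊢
  have hcau : CauchySeq fun n => (s n).1 := by
    rw [Metric.cauchySeq_iff]
    intro ε hε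
    obtain ⟨n₀, h⟩ := hs (ε * ε) (by positivity)
    refine ⟨n₀, fun m hm n hn' => ?_⟩
    rw [dist_eq_norm]
    exact lt_of_mul_self_lt_mul_self₀ hε.le (h m hm n hn')
  obtain ⟨x, hx⟩ := cauchySeq_tendsto_of_complete hcau
  have hxY : x ∈ Y := hc.mem_of_tendsto hx (Filter.Eventually.of_forall fun n => (s n).2)
  refine ⟨⟨x, hxY⟩, fun ε hε => ?_⟩
  obtain ⟨n₀, h⟩ := (Metric.tendsto_atTop.1 hx) (√ε) (Real.sqrt_pos.2 hε)
  refine ⟨n₀, fun n hn' => ?_⟩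
  have h1 := h n hn'
  rw [dist_eq_norm] at h1
  exact (mul_self_lt_mul_self (norm_nonneg _) h1).trans_eq (Real.mul_self_sqrt hε.le)

theorem operator_definite (X : H →L[ℂ] K) (h : ContinuousLinearMap.adjoint X ∘L X = 0) : X = 0 := by
  have h2 := ContinuousLinearMap.norm_adjoint_comp_self X
  rw [h, norm_zero] at h2
  exact norm_eq_zero.1 (mul_self_eq_zero.1 h2.symm)

/-- A norm closed space `Y` of operators `H → K` with `λ(N) Y N ⊆ Y` and `Y* Y ⊆ N`, for a
representation `λ` of `N` on `K`, as a correspondence over `N` with inner product `⟨X, Y⟩ = X* Y`.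
-/
abbrev operatorCorrespondence (N : VonNeumannAlgebra H) (Y : Submodule ℂ (H →L[ℂ] K))
    (lam : El N →⋆ₐ[ℂ] (K →L[ℂ] K)) (hl : ∀ a, ∀ X ∈ Y, lam a ∘L X ∈ Y)
    (hr : ∀ a : El N, ∀ X ∈ Y, X ∘L (a : H →L[ℂ] H) ∈ Y)
    (hi : ∀ X ∈ Y, ∀ Z ∈ Y, ContinuousLinearMap.adjoint X ∘L Z ∈ N)
    (hc : IsClosed (Y : Set (H →L[ℂ] K))) : Correspondence N Y where
  lact :=
    { toFun := fun a =>
        { toFun := fun X => ⟨lam a ∘L X.1, hl a X.1 X.2⟩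
          map_add' := fun X Z => Subtype.ext (by simp)
          map_smul' := fun c X => Subtype.ext (by simp) }
      map_one' := by ext X h; simp
      map_mul' := fun a b => by ext X h; simp
      map_zero' := by ext X h; simp
      map_add' := fun a b => by ext X h; simp
      commutes' := fun c => by ext X h; simp [Algebra.algebraMap_eq_smul_one] }
  ract :=
    { toFun := fun a =>
        { toFun := fun X => ⟨X.1 ∘L (a.unop : H →L[ℂ] H), hr a.unop X.1 X.2⟩
          map_add' := fun X Z => Subtype.ext (by simp)
          map_smul' := fun c X => Subtype.ext (by simp) }
      map_one' := by ext X h; simp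
      map_mul' := fun a b => by ext X h; simp
      map_zero' := by ext X h; simp
      map_add' := fun a b => by ext X h; simp
      commutes' := fun c => by ext X h; simp [Algebra.algebraMap_eq_smul_one] }
  inner := LinearMap.mk₂'ₛₗ (starRingEnd ℂ) (RingHom.id ℂ)
    (fun X Z => ⟨ContinuousLinearMap.adjoint X.1 ∘L Z.1, hi X.1 X.2 Z.1 Z.2⟩)
    (fun _ _ _ => Subtype.ext (by simp))
    (fun c X _ => Subtype.ext (by simp [map_smulₛₗ ContinuousLinearMap.adjoint c X.1]))
    (fun _ _ _ => Subtype.ext (by simp)) (fun _ _ _ => Subtype.ext (by simp))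
  lact_ract a b X := rfl
  star_inner X Z := Subtype.ext (by
    simp [ContinuousLinearMap.star_eq_adjoint, ContinuousLinearMap.adjoint_comp])
  inner_ract X Z a := rfl
  inner_lact a X Z := Subtype.ext (by
    simp only [LinearMap.mk₂'ₛₗ_apply]
    change ContinuousLinearMap.adjoint (lam a ∘L X.1) ∘L Z.1 =
      ContinuousLinearMap.adjoint X.1 ∘L (lam (star a) ∘L Z.1)
    rw [ContinuousLinearMap.adjoint_comp, map_star, ContinuousLinearMap.star_eq_adjoint,
      ContinuousLinearMap.comp_assoc])
  inner_pos X h := by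
    have : ∑ i, ∑ j, ⟪h i, ContinuousLinearMap.adjoint (X i).1 ((X j).1 (h j))⟫_ℂ =
        ((‖∑ i, (X i).1 (h i)‖ ^ 2 : ℝ) : ℂ) := by
      have h2 : ⟪∑ i, (X i).1 (h i), ∑ i, (X i).1 (h i)⟫_ℂ =
          ((‖∑ i, (X i).1 (h i)‖ ^ 2 : ℝ) : ℂ) := by
        rw [inner_self_eq_norm_sq_to_K]; simp
      rw [← h2]
      simp only [sum_inner, inner_sum, ContinuousLinearMap.adjoint_inner_right]
      exact Finset.sum_comm
    refine le_of_le_of_eq ?_ this.symm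
    rw [Complex.zero_le_real]
    positivity
  inner_definite X hX := Subtype.ext (operator_definite X.1 (congrArg Subtype.val hX))
  complete s hs := operator_complete Y hc s hs

end Operator

end Corr

section Intertwiner

variable {H : Type u} [NormedAddCommGroup H] [InnerProductSpace ℂ H] [CompleteSpace H]
variable {M : VonNeumannAlgebra H}
variable {K : Type v} [NormedAddCommGroup K] [InnerProductSpace ℂ K] [CompleteSpace K]

/-- The intertwining space `L_M(H, K) = {X : H → K | X T = π(T) X for all T ∈ M}`. -/
def BiRep.intertwiners (ρ : BiRep M K) : Submodule ℂ (H →L[ℂ] K) where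
  carrier := {X | Intertwines (stdRep M) ρ X}
  add_mem' := fun {X Z} hX hZ S => by
    rw [ContinuousLinearMap.add_comp, ContinuousLinearMap.comp_add, hX S, hZ S]
  zero_mem' := fun S => by simp
  smul_mem' := fun c X hX S => by
    rw [ContinuousLinearMap.smul_comp, ContinuousLinearMap.comp_smul, hX S]

theorem BiRep.mem_intertwiners {ρ : BiRep M K} {X : H →L[ℂ] K} :
    X ∈ ρ.intertwiners ↔ Intertwines (stdRep M) ρ X := Iff.rfl

/-- The correspondence structure of `L_M(H, K)` over the commutant of `M`: left action
`R · X = right(R) X`, right action `X · R = X R`, inner product `⟨X, Y⟩ = X* Y`. -/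
instance (ρ : BiRep M K) : Correspondence M.commutant ρ.intertwiners :=
  operatorCorrespondence M.commutant ρ.intertwiners ρ.right
    (fun R X hX => (ρ.intertwines_right R).comp hX)
    (fun R X hX => Intertwines.comp (ρ := stdRep M) hX ((stdRep M).intertwines_right R))
    (fun X hX Z hZ => VonNeumannAlgebra.mem_commutant_iff.2 fun T hT =>
      (((hX.adjoint).comp hZ) ⟨T, hT⟩).symm)
    (by
      have : ((ρ.intertwiners : Submodule ℂ (H →L[ℂ] K)) : Set (H →L[ℂ] K)) =
          ⋂ S : El M, {X | X ∘L (stdRep M).left S = ρ.left S ∘L X} := by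
        ext X; simp [BiRep.mem_intertwiners, Intertwines]
      rw [this]
      exact isClosed_iInter fun S => isClosed_eq (by fun_prop) (by fun_prop))

theorem BiRep.inner_coe (ρ : BiRep M K) (X Y : ρ.intertwiners) :
    ((Correspondence.inner (N := M.commutant) X Y : El M.commutant) : H →L[ℂ] H) =
      ContinuousLinearMap.adjoint X.1 ∘L Y.1 := rfl

theorem BiRep.lact_coe (ρ : BiRep M K) (R : El M.commutant) (X : ρ.intertwiners) :
    ((Correspondence.lact R X : ρ.intertwiners) : H →L[ℂ] K) = ρ.right R ∘L X.1 := rfl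

theorem BiRep.ract_coe (ρ : BiRep M K) (R : (El M.commutant)ᵐᵒᵖ) (X : ρ.intertwiners) :
    ((Correspondence.ract R X : ρ.intertwiners) : H →L[ℂ] K) =
      X.1 ∘L (R.unop : H →L[ℂ] H) := rfl

namespace NormalUCP

/-- The correspondence `L_M(H, M ⊗_P H)`. -/
abbrev LM (P : NormalUCP M) : Type _ := (P.dil (stdRep M)).intertwiners

/-- The Hilbert space `M ⊗_Q M ⊗_P H = M ⊗_Q (M ⊗_P H)`, with its representations of `M`
(by left multiplication) and of the commutant of `M` (by `R ↦ I ⊗ I ⊗ R`). -/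
abbrev dil₂ (P Q : NormalUCP M) : BiRep M (Q.Dil (P.dil (stdRep M))) := Q.dil (P.dil (stdRep M))

/-- The correspondence `L_M(H, M ⊗_Q M ⊗_P H)`. -/
abbrev LM₂ (P Q : NormalUCP M) : Type _ := (P.dil₂ Q).intertwiners

/-- The map `W_P h = I ⊗ h`. -/
def W (P : NormalUCP M) : H →L[ℂ] P.Dil (stdRep M) := (P.kernel (stdRep M)).creation 1

theorem W_apply (P : NormalUCP M) (h : H) : P.W h = P.elem (stdRep M) 1 h := rfl

/-- The map `V₀ : M ⊗_{PQ} H → M ⊗_Q M ⊗_P H`, `V₀ (S ⊗ h) = S ⊗ I ⊗ h`. -/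
def V₀ (P Q : NormalUCP M) : (P.comp Q).Dil (stdRep M) →L[ℂ] Q.Dil (P.dil (stdRep M)) :=
  ((P.comp Q).kernel (stdRep M)).lift
    ((Q.kernel (P.dil (stdRep M))).of ∘ₗ TensorProduct.map LinearMap.id P.W.toLinearMap) (by
      refine ⟨1, fun z => le_of_eq ?_⟩
      obtain ⟨n, T, h, rfl⟩ := TensorProduct.exists_sum_tmul_eq z
      have h0 : ((Q.kernel (P.dil (stdRep M))).of ∘ₗ
          TensorProduct.map LinearMap.id P.W.toLinearMap) (∑ i, T i ⊗ₜ[ℂ] h i) =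
          (Q.kernel (P.dil (stdRep M))).of (∑ i, T i ⊗ₜ[ℂ] P.W (h i)) := by simp [map_sum]
      have h1 := (Q.kernel (P.dil (stdRep M))).norm_sq_of_sum T fun i => P.W (h i)
      have h2 := ((P.comp Q).kernel (stdRep M)).norm_sq_of_sum T h
      have h3 : ∀ i j, ⟪P.W (h i), (Q.kernel (P.dil (stdRep M))).ker (T i) (T j) (P.W (h j))⟫_ℂ =
          ⟪h i, ((P.comp Q).kernel (stdRep M)).ker (T i) (T j) (h j)⟫_ℂ := by
        intro i j
        rw [kernel_apply, kernel_apply, W_apply, W_apply, dil_left_elem, inner_elem, star_one,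
          one_mul, mul_one]
        rfl
      simp only [h3] at h1
      have h4 := h1.trans h2.symm
      rw [h0, one_mul]
      have h5 : ‖(Q.kernel (P.dil (stdRep M))).of (∑ i, T i ⊗ₜ[ℂ] P.W (h i))‖ ^ 2 =
        ‖((P.comp Q).kernel (stdRep M)).of (∑ i, T i ⊗ₜ[ℂ] h i)‖ ^ 2 := by exact_mod_cast h4
      exact (sq_eq_sq₀ (norm_nonneg _) (norm_nonneg _)).1 h5)

theorem V₀_elem (P Q : NormalUCP M) (S : El M) (h : H) :
    P.V₀ Q ((P.comp Q).elem (stdRep M) S h) =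
      Q.elem (P.dil (stdRep M)) S (P.elem (stdRep M) 1 h) :=
  PosKernel.lift_of _ _ _ _

theorem V₀_intertwines (P Q : NormalUCP M) :
    Intertwines ((P.comp Q).dil (stdRep M)) (P.dil₂ Q) (P.V₀ Q) := fun S =>
  ext_elem _ _ fun T h => by
    rw [ContinuousLinearMap.comp_apply, ContinuousLinearMap.comp_apply, dil_left_elem, V₀_elem,
      V₀_elem, dil_left_elem]

/-- The map `V : L_M(H, M ⊗_{PQ} H) → L_M(H, M ⊗_Q M ⊗_P H)`, `V X = V₀ X`, with its adjoint
`Z ↦ V₀* Z`. -/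
def V (P Q : NormalUCP M) : AdjMap M.commutant (P.comp Q).LM (P.LM₂ Q) where
  map :=
    { toFun := fun X => ⟨P.V₀ Q ∘L X.1, (P.V₀_intertwines Q).comp X.2⟩
      map_add' := fun X Z => Subtype.ext (ContinuousLinearMap.comp_add _ X.1 Z.1)
      map_smul' := fun c X => Subtype.ext (ContinuousLinearMap.comp_smul _ c X.1) }
  adj :=
    { toFun := fun Z => ⟨ContinuousLinearMap.adjoint (P.V₀ Q) ∘L Z.1,
        (P.V₀_intertwines Q).adjoint.comp Z.2⟩
      map_add' := fun X Z => Subtype.ext (ContinuousLinearMap.comp_add _ X.1 Z.1)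
      map_smul' := fun c X => Subtype.ext (ContinuousLinearMap.comp_smul _ c X.1) }
  map_inner X Z := Subtype.ext (by
    rw [BiRep.inner_coe, BiRep.inner_coe]
    change ContinuousLinearMap.adjoint (P.V₀ Q ∘L X.1) ∘L Z.1 =
      ContinuousLinearMap.adjoint X.1 ∘L (ContinuousLinearMap.adjoint (P.V₀ Q) ∘L Z.1)
    rw [ContinuousLinearMap.adjoint_comp, ContinuousLinearMap.comp_assoc])

/-- The operator `(I ⊗ X) Y : H → M ⊗_Q M ⊗_P H`, for `X ∈ L_M(H, M ⊗_P H)` and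
`Y ∈ L_M(H, M ⊗_Q H)`. -/
def psiOp (P Q : NormalUCP M) (X : P.LM) (Y : Q.LM) : H →L[ℂ] Q.Dil (P.dil (stdRep M)) :=
  Q.idTensor (stdRep M) (P.dil (stdRep M)) X.1 X.2 ∘L Y.1

/-- The closed subspace `M ⊗_Q I ⊗_P H` of `M ⊗_Q M ⊗_P H`. -/
def midI (P Q : NormalUCP M) : Submodule ℂ (Q.Dil (P.dil (stdRep M))) :=
  (Submodule.span ℂ (Set.range fun x : El M × H =>
    Q.elem (P.dil (stdRep M)) x.1 (P.elem (stdRep M) 1 x.2))).topologicalClosure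

/-- The densely defined map `Φ_Y : M ⊗ H → H`, `Φ_Y (S ⊗ h) = S Y* h`. -/
def phiPre (Y : H →L[ℂ] H) : El M ⊗[ℂ] H →ₗ[ℂ] H :=
  TensorProduct.lift (LinearMap.mk₂ ℂ
    (fun S h => (S : H →L[ℂ] H) (ContinuousLinearMap.adjoint Y h))
    (by intros; simp) (by intros; simp) (by intros; simp) (by intros; simp))

theorem phiPre_tmul (Y : H →L[ℂ] H) (S : El M) (h : H) :
    phiPre Y (S ⊗ₜ[ℂ] h) = (S : H →L[ℂ] H) (ContinuousLinearMap.adjoint Y h) := rfl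

theorem phiPre_add (Y Z : H →L[ℂ] H) :
    phiPre (M := M) (Y + Z) = phiPre Y + phiPre Z :=
  TensorProduct.ext' fun S h => by simp [phiPre_tmul]

theorem phiPre_smul (c : ℂ) (Y : H →L[ℂ] H) :
    phiPre (M := M) (c • Y) = (starRingEnd ℂ c) • phiPre Y :=
  TensorProduct.ext' fun S h => by
    simp [phiPre_tmul, map_smulₛₗ ContinuousLinearMap.adjoint c Y]

/-- The Arveson space `E_P`: all `Y ∈ B(H)` for which `Φ_Y` is continuous for the seminorm
of `M ⊗_P H`. -/
def arveson (P : NormalUCP M) : Submodule ℂ (H →L[ℂ] H) where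
  carrier := {Y | Continuous fun z : (P.kernel (stdRep M)).Pre =>
    phiPre Y ((P.kernel (stdRep M)).toPre.symm z)}
  add_mem' := fun {Y Z} hY hZ => by
    simp only [Set.mem_ofPred_eq, phiPre_add] at *
    exact hY.add hZ
  zero_mem' := by
    have : phiPre (M := M) (0 : H →L[ℂ] H) = 0 := TensorProduct.ext' fun S h => by
      simp [phiPre_tmul]
    simp only [Set.mem_ofPred_eq, this]
    exact continuous_const
  smul_mem' := fun c Y hY => by
    simp only [Set.mem_ofPred_eq, phiPre_smul] at *
    exact hY.const_smul _

theorem mem_arveson_iff (P : NormalUCP M) (Y : H →L[ℂ] H) :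
    Y ∈ P.arveson ↔ ∃ C : ℝ, ∀ z, ‖phiPre Y z‖ ≤ C * ‖(P.kernel (stdRep M)).of z‖ := by
  constructor
  · intro hY
    let f : (P.kernel (stdRep M)).Pre →L[ℂ] H :=
      ⟨phiPre Y ∘ₗ (P.kernel (stdRep M)).toPre.symm.toLinearMap, hY⟩
    refine ⟨‖f‖, fun z => ?_⟩
    rw [PosKernel.norm_of]
    exact f.le_opNorm ((P.kernel (stdRep M)).toPre z)
  · rintro ⟨C, hC⟩
    refine (LinearMap.mkContinuousOfExistsBound
      (phiPre Y ∘ₗ (P.kernel (stdRep M)).toPre.symm.toLinearMap) ⟨C, fun z => ?_⟩).continuous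
    refine (hC ((P.kernel (stdRep M)).toPre.symm z)).trans_eq ?_
    rw [PosKernel.norm_of]; rfl

/-- The continuous extension `Φ_Y : M ⊗_P H → H`, for `Y ∈ E_P`. -/
def Phi (P : NormalUCP M) (Y : P.arveson) : P.Dil (stdRep M) →L[ℂ] H :=
  (P.kernel (stdRep M)).lift (phiPre Y.1) ((P.mem_arveson_iff Y.1).1 Y.2)

theorem Phi_elem (P : NormalUCP M) (Y : P.arveson) (S : El M) (h : H) :
    P.Phi Y (P.elem (stdRep M) S h) = (S : H →L[ℂ] H) (ContinuousLinearMap.adjoint Y.1 h) :=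
  PosKernel.lift_of _ _ _ _

theorem Phi_add (P : NormalUCP M) (Y Z : P.arveson) : P.Phi (Y + Z) = P.Phi Y + P.Phi Z :=
  P.ext_elem _ fun S h => by
    rw [_root_.add_apply, Phi_elem, Phi_elem, Phi_elem, Submodule.coe_add, map_add,
      _root_.add_apply, map_add]

theorem Phi_smul (P : NormalUCP M) (c : ℂ) (Y : P.arveson) :
    P.Phi (c • Y) = (starRingEnd ℂ c) • P.Phi Y :=
  P.ext_elem _ fun S h => by
    rw [_root_.smul_apply, Phi_elem, Phi_elem, Submodule.coe_smul,
      map_smulₛₗ ContinuousLinearMap.adjoint c Y.1, _root_.smul_apply, map_smul]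

theorem adjoint_Phi_smul (P : NormalUCP M) (c : ℂ) (Y : P.arveson) :
    ContinuousLinearMap.adjoint (P.Phi (c • Y)) = c • ContinuousLinearMap.adjoint (P.Phi Y) := by
  rw [Phi_smul, map_smulₛₗ ContinuousLinearMap.adjoint _ (P.Phi Y), Complex.conj_conj]

theorem Phi_intertwines (P : NormalUCP M) (Y : P.arveson) :
    Intertwines (P.dil (stdRep M)) (stdRep M) (P.Phi Y) := fun S =>
  ext_elem _ _ fun T h => by
    rw [ContinuousLinearMap.comp_apply, ContinuousLinearMap.comp_apply, dil_left_elem, Phi_elem,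
      Phi_elem]
    rfl

theorem adjoint_W_mem (P : NormalUCP M) (X : P.LM) :
    ContinuousLinearMap.adjoint P.W ∘L X.1 ∈ P.arveson := by
  rw [mem_arveson_iff]
  refine ⟨‖ContinuousLinearMap.adjoint X.1‖, fun z => ?_⟩
  have : phiPre (ContinuousLinearMap.adjoint P.W ∘L X.1) =
      (ContinuousLinearMap.adjoint X.1).toLinearMap ∘ₗ (P.kernel (stdRep M)).of :=
    TensorProduct.ext' fun S h => by
      rw [phiPre_tmul, ContinuousLinearMap.adjoint_comp, ContinuousLinearMap.adjoint_adjoint,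
        ContinuousLinearMap.comp_apply, W_apply]
      have h1 := (Intertwines.adjoint X.2).apply S (P.elem (stdRep M) 1 h)
      rw [dil_left_elem, mul_one] at h1
      exact h1.symm
  rw [this]
  exact (ContinuousLinearMap.adjoint X.1).le_opNorm _

/-- The linear bijection `U_P : E_P → L_M(H, M ⊗_P H)`, `Y ↦ Φ_Y*`; its inverse is
`X ↦ W_P* X`. -/
def ULin (P : NormalUCP M) : P.arveson ≃ₗ[ℂ] P.LM where
  toFun Y := ⟨ContinuousLinearMap.adjoint (P.Phi Y), (P.Phi_intertwines Y).adjoint⟩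
  invFun X := ⟨ContinuousLinearMap.adjoint P.W ∘L X.1, P.adjoint_W_mem X⟩
  map_add' Y Z := Subtype.ext (by
    change ContinuousLinearMap.adjoint (P.Phi (Y + Z)) = _
    rw [Phi_add, map_add]; rfl)
  map_smul' c Y := Subtype.ext (P.adjoint_Phi_smul c Y)
  left_inv Y := by
    apply Subtype.ext
    change ContinuousLinearMap.adjoint P.W ∘L ContinuousLinearMap.adjoint (P.Phi Y) = Y.1
    rw [← ContinuousLinearMap.adjoint_comp, ← ContinuousLinearMap.adjoint_adjoint Y.1]
    congr 1
    ext h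
    rw [ContinuousLinearMap.comp_apply, W_apply, Phi_elem]
    rfl
  right_inv X := by
    apply Subtype.ext
    rw [← ContinuousLinearMap.adjoint_adjoint X.1]
    change ContinuousLinearMap.adjoint _ = _
    congr 1
    refine P.ext_elem _ fun S h => ?_
    rw [Phi_elem]
    change (S : H →L[ℂ] H) (ContinuousLinearMap.adjoint
      (ContinuousLinearMap.adjoint P.W ∘L X.1) h) = _
    rw [ContinuousLinearMap.adjoint_comp, ContinuousLinearMap.adjoint_adjoint,
      ContinuousLinearMap.comp_apply, W_apply]
    have h1 := (Intertwines.adjoint X.2).apply S (P.elem (stdRep M) 1 h)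
    rw [dil_left_elem, mul_one] at h1
    exact h1.symm

theorem ULin_coe (P : NormalUCP M) (Y : P.arveson) :
    (P.ULin Y).1 = ContinuousLinearMap.adjoint (P.Phi Y) := rfl

theorem ULin_symm_coe (P : NormalUCP M) (X : P.LM) :
    (P.ULin.symm X).1 = ContinuousLinearMap.adjoint P.W ∘L X.1 := rfl

theorem adjoint_W_right (P : NormalUCP M) (R : El M.commutant) :
    ContinuousLinearMap.adjoint P.W ∘L (P.dil (stdRep M)).right R =
      (R : H →L[ℂ] H) ∘L ContinuousLinearMap.adjoint P.W := by
  have : (P.dil (stdRep M)).right (star R) ∘L P.W = P.W ∘L (star (R : H →L[ℂ] H)) := by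
    ext h
    rw [ContinuousLinearMap.comp_apply, ContinuousLinearMap.comp_apply, W_apply, W_apply,
      dil_right_elem]
    rfl
  have h2 := congrArg ContinuousLinearMap.adjoint this
  rwa [ContinuousLinearMap.adjoint_comp, ContinuousLinearMap.adjoint_comp, map_star,
    ContinuousLinearMap.star_eq_adjoint, ContinuousLinearMap.star_eq_adjoint,
    ContinuousLinearMap.adjoint_adjoint, ContinuousLinearMap.adjoint_adjoint] at h2

theorem mul_mem_arveson (P : NormalUCP M) (R : El M.commutant) {Y : H →L[ℂ] H}
    (hY : Y ∈ P.arveson) : (R : H →L[ℂ] H) ∘L Y ∈ P.arveson := by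
  have h := (P.ULin.symm (Correspondence.lact R (P.ULin ⟨Y, hY⟩))).2
  have h2 : (P.ULin.symm (Correspondence.lact R (P.ULin ⟨Y, hY⟩))).1 = (R : H →L[ℂ] H) ∘L Y := by
    rw [ULin_symm_coe, BiRep.lact_coe, ← ContinuousLinearMap.comp_assoc, adjoint_W_right,
      ContinuousLinearMap.comp_assoc, ← ULin_symm_coe, LinearEquiv.symm_apply_apply]
  rwa [h2] at h

theorem mem_arveson_mul (P : NormalUCP M) (R : El M.commutant) {Y : H →L[ℂ] H}
    (hY : Y ∈ P.arveson) : Y ∘L (R : H →L[ℂ] H) ∈ P.arveson := by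
  have h := (P.ULin.symm (Correspondence.ract (MulOpposite.op R) (P.ULin ⟨Y, hY⟩))).2
  have h2 : (P.ULin.symm (Correspondence.ract (MulOpposite.op R) (P.ULin ⟨Y, hY⟩))).1 =
      Y ∘L (R : H →L[ℂ] H) := by
    rw [ULin_symm_coe, BiRep.ract_coe, ← ContinuousLinearMap.comp_assoc, ← ULin_symm_coe,
      LinearEquiv.symm_apply_apply]
    rfl
  rwa [h2] at h

/-- The left action `R · Y = R Y` on `E_P`. -/
def arvesonLact (P : NormalUCP M) : El M.commutant →ₐ[ℂ] Module.End ℂ P.arveson where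
  toFun := fun R =>
    { toFun := fun Y => ⟨(R : H →L[ℂ] H) ∘L Y.1, P.mul_mem_arveson R Y.2⟩
      map_add' := fun X Z => Subtype.ext (by simp)
      map_smul' := fun c X => Subtype.ext (by simp) }
  map_one' := by ext X h; simp
  map_mul' := fun a b => by ext X h; simp
  map_zero' := by ext X h; simp
  map_add' := fun a b => by ext X h; simp
  commutes' := fun c => by ext X h; simp [Algebra.algebraMap_eq_smul_one]

/-- The right action `Y · R = Y R` on `E_P`. -/
def arvesonRact (P : NormalUCP M) : (El M.commutant)ᵐᵒᵖ →ₐ[ℂ] Module.End ℂ P.arveson where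
  toFun := fun R =>
    { toFun := fun Y => ⟨Y.1 ∘L (R.unop : H →L[ℂ] H), P.mem_arveson_mul R.unop Y.2⟩
      map_add' := fun X Z => Subtype.ext (by simp)
      map_smul' := fun c X => Subtype.ext (by simp) }
  map_one' := by ext X h; simp
  map_mul' := fun a b => by ext X h; simp
  map_zero' := by ext X h; simp
  map_add' := fun a b => by ext X h; simp
  commutes' := fun c => by ext X h; simp [Algebra.algebraMap_eq_smul_one]

theorem ULin_lact (P : NormalUCP M) (R : El M.commutant) (Y : P.arveson) :
    P.ULin (P.arvesonLact R Y) = Correspondence.lact R (P.ULin Y) := by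
  rw [← LinearEquiv.eq_symm_apply]
  apply Subtype.ext
  rw [ULin_symm_coe, BiRep.lact_coe, ← ContinuousLinearMap.comp_assoc, adjoint_W_right,
    ContinuousLinearMap.comp_assoc, ← ULin_symm_coe, LinearEquiv.symm_apply_apply]
  rfl

theorem ULin_ract (P : NormalUCP M) (R : (El M.commutant)ᵐᵒᵖ) (Y : P.arveson) :
    P.ULin (P.arvesonRact R Y) = Correspondence.ract R (P.ULin Y) := by
  rw [← LinearEquiv.eq_symm_apply]
  apply Subtype.ext
  rw [ULin_symm_coe, BiRep.ract_coe, ← ContinuousLinearMap.comp_assoc, ← ULin_symm_coe,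
    LinearEquiv.symm_apply_apply]
  rfl

/-- The inner product `⟨Y, Z⟩ = Φ_Y Φ_Z*` on `E_P`. -/
def arvesonInner (P : NormalUCP M) : P.arveson →ₗ⋆[ℂ] P.arveson →ₗ[ℂ] El M.commutant :=
  LinearMap.mk₂'ₛₗ (starRingEnd ℂ) (RingHom.id ℂ)
    (fun Y Z => ⟨P.Phi Y ∘L ContinuousLinearMap.adjoint (P.Phi Z),
      VonNeumannAlgebra.mem_commutant_iff.2 fun T hT =>
        (((P.Phi_intertwines Y).comp (P.Phi_intertwines Z).adjoint) ⟨T, hT⟩).symm⟩)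
    (fun Y Y' Z => Subtype.ext (by
      change P.Phi (Y + Y') ∘L _ = P.Phi Y ∘L _ + P.Phi Y' ∘L _
      rw [Phi_add, ContinuousLinearMap.add_comp]))
    (fun c Y Z => Subtype.ext (by
      change P.Phi (c • Y) ∘L _ = (starRingEnd ℂ c) • (P.Phi Y ∘L _)
      rw [Phi_smul, ContinuousLinearMap.smul_comp]))
    (fun Y Z Z' => Subtype.ext (by
      change P.Phi Y ∘L ContinuousLinearMap.adjoint (P.Phi (Z + Z')) =
        P.Phi Y ∘L ContinuousLinearMap.adjoint (P.Phi Z) +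
        P.Phi Y ∘L ContinuousLinearMap.adjoint (P.Phi Z')
      rw [Phi_add, map_add, ContinuousLinearMap.comp_add]))
    (fun c Y Z => Subtype.ext (by
      change P.Phi Y ∘L ContinuousLinearMap.adjoint (P.Phi (c • Z)) =
        c • (P.Phi Y ∘L ContinuousLinearMap.adjoint (P.Phi Z))
      rw [adjoint_Phi_smul, ContinuousLinearMap.comp_smul]))

theorem ULin_inner (P : NormalUCP M) (Y Z : P.arveson) :
    P.arvesonInner Y Z = Correspondence.inner (P.ULin Y) (P.ULin Z) :=
  Subtype.ext (by
    rw [BiRep.inner_coe, ULin_coe, ULin_coe, ContinuousLinearMap.adjoint_adjoint]; rfl)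

/-- The Arveson correspondence `E_P` over the commutant of `M`. -/
instance (P : NormalUCP M) : Correspondence M.commutant P.arveson where
  lact := P.arvesonLact
  ract := P.arvesonRact
  inner := P.arvesonInner
  lact_ract a b x := rfl
  star_inner x y := by rw [ULin_inner, ULin_inner, Correspondence.star_inner]
  inner_ract x y a := by rw [ULin_inner, ULin_inner, ULin_ract, Correspondence.inner_ract]
  inner_lact a x y := by
    rw [ULin_inner, ULin_inner, ULin_lact, ULin_lact, Correspondence.inner_lact]
  inner_pos x := by
    simp only [ULin_inner]
    exact Correspondence.inner_pos fun i => P.ULin (x i)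
  inner_definite x hx := by
    rw [ULin_inner] at hx
    exact (LinearEquiv.map_eq_zero_iff _).1 (Correspondence.inner_definite _ hx)
  complete s hs := by
    have key : ∀ Y Z : P.arveson, P.arvesonInner (Y - Z) (Y - Z) =
        Correspondence.inner (P.ULin Y - P.ULin Z) (P.ULin Y - P.ULin Z) := fun Y Z => by
      rw [ULin_inner, map_sub]
    simp only [key] at hs ⊢
    obtain ⟨x, hx⟩ := Correspondence.complete (N := M.commutant) (fun n => P.ULin (s n)) hs
    refine ⟨P.ULin.symm x, ?_⟩
    simpa only [LinearEquiv.apply_symm_apply] using hx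

/-- The isomorphism of correspondences `U_P : E_P → L_M(H, M ⊗_P H)`, `Y ↦ Φ_Y*`. -/
def U (P : NormalUCP M) : CorrIso M.commutant P.arveson P.LM where
  toLinearEquiv := P.ULin
  map_lact := P.ULin_lact
  map_ract := P.ULin_ract
  map_inner Y Z := (P.ULin_inner Y Z).symm

end NormalUCP

end Intertwiner

section Tensor

variable {H : Type u} [NormedAddCommGroup H] [InnerProductSpace ℂ H] [CompleteSpace H]
variable (N : VonNeumannAlgebra H)
variable (E F : Type*) [AddCommGroup E] [Module ℂ E] [AddCommGroup F] [Module ℂ F]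
  [Correspondence N E] [Correspondence N F]

/-- The `N`-valued form `⟨x ⊗ y, x' ⊗ y'⟩ = ⟨y, ⟨x, x'⟩ y'⟩` on the algebraic tensor product. -/
def tensorInner : E ⊗[ℂ] F →ₗ⋆[ℂ] E ⊗[ℂ] F →ₗ[ℂ] El N :=
  TensorProduct.lift (LinearMap.mk₂'ₛₗ (starRingEnd ℂ) (starRingEnd ℂ)
    (fun x y => TensorProduct.lift
      (LinearMap.mk₂ ℂ (fun x' y' =>
          Correspondence.inner (N := N) y
            (Correspondence.lact (Correspondence.inner (N := N) x x') y'))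
        (by intros; simp) (by intros; simp) (by intros; simp) (by intros; simp)))
    (by intros; ext; simp) (by intros; ext; simp)
    (by intros; ext; simp) (by intros; ext; simp))

variable {E F}

theorem tensorInner_tmul (x x' : E) (y y' : F) :
    tensorInner N E F (x ⊗ₜ y) (x' ⊗ₜ y') =
      Correspondence.inner y
        (Correspondence.lact (Correspondence.inner (N := N) x x') y') := rfl

theorem star_tensorInner (z z' : E ⊗[ℂ] F) :
    star (tensorInner N E F z z') = tensorInner N E F z' z := by
  induction z with
  | zero => simp
  | add a b ha hb => simp only [map_add, LinearMap.add_apply, star_add, ha, hb]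
  | tmul x y =>
    induction z' with
    | zero => simp
    | add a b ha hb => simp only [map_add, LinearMap.add_apply, star_add, ha, hb]
    | tmul x' y' =>
      rw [tensorInner_tmul, tensorInner_tmul, Correspondence.star_inner,
        Correspondence.inner_lact, Correspondence.star_inner]

theorem tensorInner_pos_pure {ι : Type} [Fintype ι] (x : ι → E) (y : ι → F) :
    MatrixPos fun i j => (tensorInner N E F (x i ⊗ₜ y i) (x j ⊗ₜ y j) : H →L[ℂ] H) := by
  intro h
  obtain ⟨C, hC⟩ := exists_gram N (fun i j => Correspondence.inner (N := N) (x i) (x j))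
    (Correspondence.inner_pos x)
  have h1 : ∀ i j, tensorInner N E F (x i ⊗ₜ y i) (x j ⊗ₜ y j) =
      ∑ k, Correspondence.inner (N := N) (Correspondence.lact (C k i) (y i))
        (Correspondence.lact (C k j) (y j)) := by
    intro i j
    rw [tensorInner_tmul, hC, map_sum, LinearMap.sum_apply, map_sum]
    refine Finset.sum_congr rfl fun k _ => ?_
    rw [map_mul, Module.End.mul_apply, Correspondence.inner_lact]
  have h2 : ∑ i, ∑ j, ⟪h i, (tensorInner N E F (x i ⊗ₜ y i) (x j ⊗ₜ y j) : H →L[ℂ] H) (h j)⟫_ℂ =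
      ∑ k, ∑ i, ∑ j, ⟪h i, (Correspondence.inner (N := N) (Correspondence.lact (C k i) (y i))
        (Correspondence.lact (C k j) (y j)) : El N).1 (h j)⟫_ℂ := by
    simp only [h1, AddSubmonoidClass.coe_finsetSum, _root_.sum_apply, inner_sum]
    rw [Finset.sum_comm (s := (Finset.univ : Finset ι)) (t := (Finset.univ : Finset ι))]
    refine (Finset.sum_congr rfl fun i _ => Finset.sum_comm).trans ?_
    rw [Finset.sum_comm]
    exact Finset.sum_congr rfl fun k _ => Finset.sum_comm
  rw [h2]
  exact Finset.sum_nonneg fun k _ =>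
    Correspondence.inner_pos (N := N) (fun i => Correspondence.lact (C k i) (y i)) h

theorem tensorInner_pos {ι : Type} [Fintype ι] (z : ι → E ⊗[ℂ] F) :
    MatrixPos fun i j => (tensorInner N E F (z i) (z j) : H →L[ℂ] H) := by
  intro h
  choose n x y hz using fun i => TensorProduct.exists_sum_tmul_eq (z i)
  have h1 := tensorInner_pos_pure N (ι := Σ i, Fin (n i)) (fun s => x s.1 s.2)
    (fun s => y s.1 s.2) fun s => h s.1
  rw [← Finset.univ_sigma_univ, Finset.sum_sigma] at h1
  simp only [Finset.sum_sigma] at h1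
  refine h1.trans_eq (Finset.sum_congr rfl fun i _ => ?_)
  rw [Finset.sum_comm]
  refine Finset.sum_congr rfl fun j _ => ?_
  simp only [hz, map_sum, LinearMap.coe_sum, Finset.sum_apply, AddSubmonoidClass.coe_finsetSum,
    _root_.sum_apply, inner_sum]
  exact Finset.sum_comm

variable (E F)

/-- The form on the algebraic tensor product of two correspondences, acting on `H`. -/
def tensorKernel : PosKernel (E ⊗[ℂ] F) H where
  ker := LinearMap.mk₂'ₛₗ (starRingEnd ℂ) (RingHom.id ℂ)
    (fun z z' => (tensorInner N E F z z' : H →L[ℂ] H))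
    (by intros; simp) (by intros; simp) (by intros; simp) (by intros; simp)
  herm z z' k k' := by
    simp only [LinearMap.mk₂'ₛₗ_apply]
    rw [← star_tensorInner N z z', StarMemClass.coe_star, ContinuousLinearMap.star_eq_adjoint,
      ContinuousLinearMap.adjoint_inner_right]
  pos := tensorInner_pos N

theorem tensorKernel_apply (z z' : E ⊗[ℂ] F) :
    (tensorKernel N E F).ker z z' = (tensorInner N E F z z' : H →L[ℂ] H) := rfl

/-- The Hilbert space `E ⊗_N F ⊗_N H`: the Hausdorff completion of `E ⊗ F ⊗ H` with respect to
`⟨x ⊗ y ⊗ h, x' ⊗ y' ⊗ h'⟩ = ⟨h, ⟨y, ⟨x, x'⟩ y'⟩ h'⟩`. -/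
abbrev TensorSpace : Type _ := (tensorKernel N E F).Space

variable {E F}

/-- The element `x ⊗ y ⊗ h`. -/
def t3 (x : E) (y : F) (h : H) : TensorSpace N E F := (tensorKernel N E F).of ((x ⊗ₜ y) ⊗ₜ h)

theorem inner_t3 (x x' : E) (y y' : F) (h h' : H) :
    ⟪t3 N x y h, t3 N x' y' h'⟫_ℂ = ⟪h, (Correspondence.inner (N := N) y
      (Correspondence.lact (Correspondence.inner (N := N) x x') y') : El N).1 h'⟫_ℂ := by
  rw [t3, t3, PosKernel.inner_of, PosKernel.form_tmul, tensorKernel_apply, tensorInner_tmul]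

theorem ext_t3 {L : Type*} [NormedAddCommGroup L] [NormedSpace ℂ L]
    {f g : TensorSpace N E F →L[ℂ] L} (hfg : ∀ x y h, f (t3 N x y h) = g (t3 N x y h)) : f = g := by
  apply PosKernel.ext_clm
  intro d h
  induction d with
  | zero => simp
  | add a b ha hb => rw [TensorProduct.add_tmul, map_add, map_add, map_add, ha, hb]
  | tmul x y => exact hfg x y h

theorem ext_inner_t3 {a b : TensorSpace N E F}
    (hab : ∀ x y h, ⟪t3 N x y h, a⟫_ℂ = ⟪t3 N x y h, b⟫_ℂ) : a = b := by
  apply PosKernel.ext_inner'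
  intro d h
  induction d with
  | zero => simp
  | add a b ha hb => rw [TensorProduct.add_tmul, map_add, inner_add_left, inner_add_left, ha, hb]
  | tmul x y => exact hab x y h

/-- `a x ⊗ y`, as a linear map on the algebraic tensor product. -/
def lactAlg (a : El N) : E ⊗[ℂ] F →ₗ[ℂ] E ⊗[ℂ] F :=
  TensorProduct.map (Correspondence.lact a) LinearMap.id

theorem tensorInner_lactAlg (a : El N) (z z' : E ⊗[ℂ] F) :
    tensorInner N E F (lactAlg N a z) (lactAlg N a z') =
      tensorInner N E F z (lactAlg N (star a * a) z') := by
  induction z with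
  | zero => simp
  | add p q hp hq => simp only [map_add, LinearMap.add_apply, hp, hq]
  | tmul x y =>
    induction z' with
    | zero => simp
    | add p q hp hq => simp only [map_add, hp, hq]
    | tmul x' y' =>
      simp only [lactAlg, TensorProduct.map_tmul, LinearMap.id_apply, tensorInner_tmul]
      rw [Correspondence.inner_lact, map_mul, Module.End.mul_apply]

theorem lactAlg_add (a b : El N) : lactAlg N (E := E) (F := F) (a + b) =
    lactAlg N a + lactAlg N b := TensorProduct.ext' fun x y => by
  simp [lactAlg, TensorProduct.add_tmul]

theorem lactAlg_smul_one (c : ℂ) : lactAlg N (E := E) (F := F) (c • 1) = c • LinearMap.id :=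
  TensorProduct.ext' fun x y => by simp [lactAlg, TensorProduct.smul_tmul']

/-- The operator `x ⊗ y ⊗ h ↦ a x ⊗ y ⊗ h`. -/
def tensorLeftMul (a : El N) : TensorSpace N E F →L[ℂ] TensorSpace N E F :=
  (tensorKernel N E F).lift
    ((tensorKernel N E F).of ∘ₗ TensorProduct.map (lactAlg N a) LinearMap.id) (by
    refine ⟨‖(a : H →L[ℂ] H)‖, fun z => ?_⟩
    obtain ⟨n, d, h, rfl⟩ := TensorProduct.exists_sum_tmul_eq z
    obtain ⟨c, hc⟩ := exists_defect N a
    have h0 : ∀ a : El N, ((tensorKernel N E F).of ∘ₗ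
        TensorProduct.map (lactAlg N a) LinearMap.id) (∑ i, d i ⊗ₜ[ℂ] h i) =
        (tensorKernel N E F).of (∑ i, (lactAlg N a (d i)) ⊗ₜ[ℂ] h i) := fun a => by simp [map_sum]
    refine le_of_sq_le_sq ?_ (by positivity)
    rw [h0, mul_pow]
    have h1 := (tensorKernel N E F).norm_sq_of_sum d h
    have h2 := (tensorKernel N E F).norm_sq_of_sum (fun i => lactAlg N a (d i)) h
    have h3 := (tensorKernel N E F).norm_sq_of_sum (fun i => lactAlg N c (d i)) h
    simp only [tensorKernel_apply, tensorInner_lactAlg] at h1 h2 h3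
    have h4 : ((‖(tensorKernel N E F).of (∑ i, (lactAlg N a (d i)) ⊗ₜ[ℂ] h i)‖ ^ 2 : ℝ) : ℂ) +
        ((‖(tensorKernel N E F).of (∑ i, (lactAlg N c (d i)) ⊗ₜ[ℂ] h i)‖ ^ 2 : ℝ) : ℂ) =
        ((‖(a : H →L[ℂ] H)‖ ^ 2 : ℝ) : ℂ) *
          ((‖(tensorKernel N E F).of (∑ i, d i ⊗ₜ[ℂ] h i)‖ ^ 2 : ℝ) : ℂ) := by
      rw [h1, h2, h3, ← Finset.sum_add_distrib, Finset.mul_sum]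
      refine Finset.sum_congr rfl fun i _ => ?_
      rw [← Finset.sum_add_distrib, Finset.mul_sum]
      refine Finset.sum_congr rfl fun j _ => ?_
      rw [← inner_add_right, ← _root_.add_apply, ← AddMemClass.coe_add, ← map_add,
        ← LinearMap.add_apply, ← lactAlg_add, hc, lactAlg_smul_one, LinearMap.smul_apply,
        LinearMap.id_apply, map_smul]
      exact inner_smul_right _ _ _
    have h5 : ‖(tensorKernel N E F).of (∑ i, (lactAlg N a (d i)) ⊗ₜ[ℂ] h i)‖ ^ 2 +
        ‖(tensorKernel N E F).of (∑ i, (lactAlg N c (d i)) ⊗ₜ[ℂ] h i)‖ ^ 2 =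
        ‖(a : H →L[ℂ] H)‖ ^ 2 * ‖(tensorKernel N E F).of (∑ i, d i ⊗ₜ[ℂ] h i)‖ ^ 2 := by
      exact_mod_cast h4
    exact (le_add_of_nonneg_right (sq_nonneg _)).trans_eq h5)

theorem tensorLeftMul_of (a : El N) (d : E ⊗[ℂ] F) (h : H) :
    tensorLeftMul N a ((tensorKernel N E F).of (d ⊗ₜ h)) =
      (tensorKernel N E F).of (lactAlg N a d ⊗ₜ h) :=
  PosKernel.lift_of _ _ _ _

theorem tensorLeftMul_t3 (a : El N) (x : E) (y : F) (h : H) :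
    tensorLeftMul N a (t3 N x y h) = t3 N (Correspondence.lact a x) y h :=
  tensorLeftMul_of N a _ h

theorem t3_add (x x' : E) (y : F) (h : H) :
    t3 N (x + x') y h = t3 N x y h + t3 N x' y h := by
  simp [t3, TensorProduct.add_tmul]

theorem t3_smul (c : ℂ) (x : E) (y : F) (h : H) : t3 N (c • x) y h = c • t3 N x y h := by
  simp [t3, ← TensorProduct.smul_tmul']

variable (E F)

/-- The representation of `N` on `E ⊗_N F ⊗_N H` through the left action on `E`. -/
def tensorLeft : El N →⋆ₐ[ℂ] (TensorSpace N E F →L[ℂ] TensorSpace N E F) where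
  toFun := tensorLeftMul N
  map_one' := ext_t3 N fun x y h => by rw [tensorLeftMul_t3, map_one]; rfl
  map_mul' a b := ext_t3 N fun x y h => by
    rw [mul_apply_eq_comp, tensorLeftMul_t3, tensorLeftMul_t3, tensorLeftMul_t3, map_mul]; rfl
  map_zero' := ext_t3 N fun x y h => by rw [tensorLeftMul_t3, map_zero]; simp [t3]
  map_add' a b := ext_t3 N fun x y h => by
    rw [_root_.add_apply, tensorLeftMul_t3, tensorLeftMul_t3, tensorLeftMul_t3, map_add,
      LinearMap.add_apply, t3_add]
  commutes' c := ext_t3 N fun x y h => by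
    rw [tensorLeftMul_t3, Algebra.algebraMap_eq_smul_one, map_smul, map_one,
      LinearMap.smul_apply, Module.End.one_apply, t3_smul, Algebra.algebraMap_eq_smul_one]
    rfl
  map_star' a := ext_t3 N fun x y h => ext_inner_t3 N fun x' y' h' => by
    rw [ContinuousLinearMap.star_eq_adjoint, ContinuousLinearMap.adjoint_inner_right,
      tensorLeftMul_t3, tensorLeftMul_t3, inner_t3, inner_t3, Correspondence.inner_lact]

/-- Operators as functions, so that the product topology on functions is the strong operator
topology. -/
def asFun (K : Type*) [NormedAddCommGroup K] [InnerProductSpace ℂ K] :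
    (H →L[ℂ] K) →ₗ[ℂ] (H → K) where
  toFun T h := T h
  map_add' _ _ := rfl
  map_smul' _ _ := rfl

/-- The `W*`-tensor product `E ⊗_N F`, that is, the self-dual completion of the balanced tensor
product: an element `d` of the algebraic tensor product is regarded as the operator `h ↦ d ⊗ h`
from `H` to `E ⊗_N F ⊗_N H`, which identifies the inner product with `⟨d, d'⟩ = d* d'`, and the
completion is the closure of these operators in the strong operator topology. -/
def wTensor : Submodule ℂ (H →L[ℂ] TensorSpace N E F) :=
  ((LinearMap.range (asFun (TensorSpace N E F) ∘ₗ
    (tensorKernel N E F).creation)).topologicalClosure).comap (asFun (TensorSpace N E F))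

variable {E F}

theorem mem_wTensor {T : H →L[ℂ] TensorSpace N E F} : T ∈ wTensor N E F ↔
    (T : H → TensorSpace N E F) ∈ closure (Set.range fun d : E ⊗[ℂ] F =>
      ((tensorKernel N E F).creation d : H → TensorSpace N E F)) := Iff.rfl

theorem creation_mem (d : E ⊗[ℂ] F) : (tensorKernel N E F).creation d ∈ wTensor N E F :=
  (mem_wTensor N).2 (subset_closure ⟨d, rfl⟩)

theorem wTensor_inner_mem {T T' : H →L[ℂ] TensorSpace N E F} (hT : T ∈ wTensor N E F)
    (hT' : T' ∈ wTensor N E F) : ContinuousLinearMap.adjoint T ∘L T' ∈ N := by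
  have key : ∀ (R : El N.commutant) (h h' : H) (f g : H → TensorSpace N E F),
      f ∈ closure (Set.range fun d : E ⊗[ℂ] F =>
        ((tensorKernel N E F).creation d : H → TensorSpace N E F)) →
      g ∈ closure (Set.range fun d : E ⊗[ℂ] F =>
        ((tensorKernel N E F).creation d : H → TensorSpace N E F)) →
      ⟪f h, g ((R : H →L[ℂ] H) h')⟫_ℂ = ⟪f ((star R : El N.commutant).1 h), g h'⟫_ℂ := by
    intro R h h' f g hf hg
    have hc : ∀ x : H, Continuous fun f : H → TensorSpace N E F => f x := fun x =>
      continuous_apply x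
    have step : ∀ d : E ⊗[ℂ] F, ⟪(tensorKernel N E F).creation d h, g ((R : H →L[ℂ] H) h')⟫_ℂ =
        ⟪(tensorKernel N E F).creation d ((star R : El N.commutant).1 h), g h'⟫_ℂ := by
      intro d
      refine closure_minimal (s := Set.range fun d : E ⊗[ℂ] F =>
        ((tensorKernel N E F).creation d : H → TensorSpace N E F))
        (t := {g | ⟪(tensorKernel N E F).creation d h, g ((R : H →L[ℂ] H) h')⟫_ℂ =
        ⟪(tensorKernel N E F).creation d ((star R : El N.commutant).1 h), g h'⟫_ℂ}) ?_
        (isClosed_eq (continuous_const.inner (hc _)) (continuous_const.inner (hc _))) hg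
      rintro _ ⟨d', rfl⟩
      change ⟪(tensorKernel N E F).creation d h,
        (tensorKernel N E F).creation d' ((R : H →L[ℂ] H) h')⟫_ℂ =
        ⟪(tensorKernel N E F).creation d ((star R : El N.commutant).1 h),
          (tensorKernel N E F).creation d' h'⟫_ℂ
      rw [PosKernel.inner_creation, PosKernel.inner_creation, tensorKernel_apply,
        StarMemClass.coe_star, ContinuousLinearMap.star_eq_adjoint,
        ContinuousLinearMap.adjoint_inner_left]
      congr 1
      exact congrArg (fun S : H →L[ℂ] H => S h') (El.comm (tensorInner N E F d d') R)
    refine closure_minimal (s := Set.range fun d : E ⊗[ℂ] F =>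
        ((tensorKernel N E F).creation d : H → TensorSpace N E F))
        (t := {f | ⟪f h, g ((R : H →L[ℂ] H) h')⟫_ℂ =
        ⟪f ((star R : El N.commutant).1 h), g h'⟫_ℂ}) ?_
        (isClosed_eq ((hc _).inner continuous_const) ((hc _).inner continuous_const)) hf
    rintro _ ⟨d, rfl⟩
    exact step d
  suffices h0 : ContinuousLinearMap.adjoint T ∘L T' ∈ N.commutant.commutant by
    rwa [VonNeumannAlgebra.commutant_commutant] at h0
  rw [VonNeumannAlgebra.mem_commutant_iff]
  intro R hR
  ext1 h'
  refine ext_inner_left ℂ fun h => ?_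
  have h1 := key ⟨R, hR⟩ h h' T T' hT hT'
  rw [mul_apply_eq_comp, mul_apply_eq_comp, ContinuousLinearMap.comp_apply,
    ContinuousLinearMap.comp_apply, ContinuousLinearMap.adjoint_inner_right, h1,
    StarMemClass.coe_star, ContinuousLinearMap.star_eq_adjoint,
    ← ContinuousLinearMap.adjoint_inner_right, ContinuousLinearMap.adjoint_inner_left]

theorem wTensor_comp_mem {E' F' : Type*} [AddCommGroup E'] [Module ℂ E'] [AddCommGroup F']
    [Module ℂ F'] [Correspondence N E'] [Correspondence N F']
    (A : TensorSpace N E F →L[ℂ] TensorSpace N E' F')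
    (hA : ∀ d, A ∘L (tensorKernel N E F).creation d ∈ wTensor N E' F')
    {T : H →L[ℂ] TensorSpace N E F} (hT : T ∈ wTensor N E F) : A ∘L T ∈ wTensor N E' F' := by
  have hc : Continuous fun f : H → TensorSpace N E F => fun h => A (f h) := by fun_prop
  rw [mem_wTensor, ← closure_closure]
  refine map_mem_closure (f := fun f : H → TensorSpace N E F => fun h => A (f h)) hc
    ((mem_wTensor N).1 hT) ?_
  rintro _ ⟨d, rfl⟩
  exact (mem_wTensor N).1 (hA d)

/-- `x ⊗ y a`, as a linear map on the algebraic tensor product. -/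
def ractAlg (a : El N) : E ⊗[ℂ] F →ₗ[ℂ] E ⊗[ℂ] F :=
  TensorProduct.map LinearMap.id (Correspondence.ract (MulOpposite.op a))

theorem creation_comp (d : E ⊗[ℂ] F) (a : El N) : (tensorKernel N E F).creation d ∘L a.1 =
    (tensorKernel N E F).creation (ractAlg N a d) := by
  induction d with
  | zero => simp
  | add p q hp hq => simp only [map_add, ContinuousLinearMap.add_comp, hp, hq]
  | tmul x y =>
    ext1 h
    refine ext_inner_t3 N fun x' y' h' => ?_
    change ⟪t3 N x' y' h', t3 N x y (a.1 h)⟫_ℂ =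
      ⟪t3 N x' y' h', t3 N x (Correspondence.ract (MulOpposite.op a) y) h⟫_ℂ
    rw [inner_t3, inner_t3, Correspondence.lact_ract, Correspondence.inner_ract]
    rfl

theorem wTensor_mul_mem (a : El N) {T : H →L[ℂ] TensorSpace N E F} (hT : T ∈ wTensor N E F) :
    T ∘L (a : H →L[ℂ] H) ∈ wTensor N E F := by
  have hc : Continuous fun f : H → TensorSpace N E F => fun h => f ((a : H →L[ℂ] H) h) := by
    fun_prop
  rw [mem_wTensor]
  refine map_mem_closure (f := fun f : H → TensorSpace N E F => fun h => f ((a : H →L[ℂ] H) h)) hc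
    ((mem_wTensor N).1 hT) ?_
  rintro _ ⟨d, rfl⟩
  exact ⟨ractAlg N a d, congrArg (fun S : H →L[ℂ] TensorSpace N E F =>
    (S : H → TensorSpace N E F)) (creation_comp N d a).symm⟩

theorem tensorLeft_comp_creation (a : El N) (d : E ⊗[ℂ] F) :
    tensorLeft N E F a ∘L (tensorKernel N E F).creation d =
      (tensorKernel N E F).creation (lactAlg N a d) := by
  ext1 h
  exact tensorLeftMul_of N a d h

theorem isClosed_wTensor : IsClosed (wTensor N E F : Set (H →L[ℂ] TensorSpace N E F)) := by
  have hc : Continuous fun T : H →L[ℂ] TensorSpace N E F => (T : H → TensorSpace N E F) :=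
    continuous_pi fun h => by fun_prop
  exact isClosed_closure.preimage hc

/-- The correspondence structure of `E ⊗_N F`: the left action is that of `N` on the first factor,
the right action that of `N` on `H`, and `⟨S, T⟩ = S* T`. -/
instance : Correspondence N (wTensor N E F) :=
  operatorCorrespondence N (wTensor N E F) (tensorLeft N E F)
    (fun a _ hX => wTensor_comp_mem N (tensorLeft N E F a)
      (fun d => by rw [tensorLeft_comp_creation]; exact creation_mem N _) hX)
    (fun a _ hX => wTensor_mul_mem N a hX)
    (fun _ hX _ hZ => wTensor_inner_mem N hX hZ)
    (isClosed_wTensor N)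

/-- The elementary tensor `x ⊗ y` in `E ⊗_N F`. -/
def wtmul (x : E) (y : F) : wTensor N E F :=
  ⟨(tensorKernel N E F).creation (x ⊗ₜ y), creation_mem N _⟩

theorem wtmul_apply (x : E) (y : F) (h : H) : (wtmul N x y).1 h = t3 N x y h := rfl

/-- The inner product of elementary tensors is `⟨x ⊗ y, x' ⊗ y'⟩ = ⟨y, ⟨x, x'⟩ y'⟩`. -/
theorem inner_wtmul (x x' : E) (y y' : F) :
    Correspondence.inner (N := N) (wtmul N x y) (wtmul N x' y') =
      Correspondence.inner y (Correspondence.lact (Correspondence.inner (N := N) x x') y') := by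
  apply Subtype.ext
  ext1 h
  refine ext_inner_left ℂ fun h' => ?_
  change ⟪h', ContinuousLinearMap.adjoint (wtmul N x y).1 ((wtmul N x' y').1 h)⟫_ℂ = _
  rw [ContinuousLinearMap.adjoint_inner_right, wtmul_apply, wtmul_apply, inner_t3]

theorem lact_wtmul (a : El N) (x : E) (y : F) :
    Correspondence.lact a (wtmul N x y) = wtmul N (Correspondence.lact a x) y :=
  Subtype.ext (tensorLeft_comp_creation N a (x ⊗ₜ y))

theorem ract_wtmul (a : El N) (x : E) (y : F) :
    Correspondence.ract (MulOpposite.op a) (wtmul N x y) =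
      wtmul N x (Correspondence.ract (MulOpposite.op a) y) :=
  Subtype.ext (creation_comp N (x ⊗ₜ y) a)

/-- The tensor product is balanced: `x a ⊗ y = x ⊗ a y`. -/
theorem wtmul_balanced (a : El N) (x : E) (y : F) :
    wtmul N (Correspondence.ract (MulOpposite.op a) x) y =
      wtmul N x (Correspondence.lact a y) := by
  apply Subtype.ext
  ext1 h
  refine ext_inner_t3 N fun x' y' h' => ?_
  rw [wtmul_apply, wtmul_apply, inner_t3, inner_t3, Correspondence.inner_ract, map_mul]
  rfl

end Tensor

namespace CorrIso

variable {H : Type u} [NormedAddCommGroup H] [InnerProductSpace ℂ H] [CompleteSpace H]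
variable {N : VonNeumannAlgebra H}
variable {E F E' F' : Type*} [AddCommGroup E] [Module ℂ E] [AddCommGroup F] [Module ℂ F]
  [AddCommGroup E'] [Module ℂ E'] [AddCommGroup F'] [Module ℂ F']
  [Correspondence N E] [Correspondence N F] [Correspondence N E'] [Correspondence N F']

/-- The map `x ⊗ y ↦ u x ⊗ v y` on algebraic tensor products. -/
def tensorAlg (u : CorrIso N E E') (v : CorrIso N F F') : E ⊗[ℂ] F →ₗ[ℂ] E' ⊗[ℂ] F' :=
  TensorProduct.map u.toLinearEquiv.toLinearMap v.toLinearEquiv.toLinearMap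

theorem tensorInner_tensorAlg (u : CorrIso N E E') (v : CorrIso N F F') (z z' : E ⊗[ℂ] F) :
    tensorInner N E' F' (tensorAlg u v z) (tensorAlg u v z') = tensorInner N E F z z' := by
  induction z with
  | zero => simp
  | add p q hp hq => simp only [map_add, LinearMap.add_apply, hp, hq]
  | tmul x y =>
    induction z' with
    | zero => simp
    | add p q hp hq => simp only [map_add, hp, hq]
    | tmul x' y' =>
      simp only [tensorAlg, TensorProduct.map_tmul, LinearEquiv.coe_coe, tensorInner_tmul]
      rw [u.map_inner, ← v.map_lact, v.map_inner]

/-- The operator `x ⊗ y ⊗ h ↦ u x ⊗ v y ⊗ h`. -/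
def tensorHilb (u : CorrIso N E E') (v : CorrIso N F F') :
    TensorSpace N E F →L[ℂ] TensorSpace N E' F' :=
  (tensorKernel N E F).lift
    ((tensorKernel N E' F').of ∘ₗ TensorProduct.map (tensorAlg u v) LinearMap.id) (by
    refine ⟨1, fun z => le_of_eq ?_⟩
    obtain ⟨n, d, h, rfl⟩ := TensorProduct.exists_sum_tmul_eq z
    have h0 : ((tensorKernel N E' F').of ∘ₗ
        TensorProduct.map (tensorAlg u v) LinearMap.id) (∑ i, d i ⊗ₜ[ℂ] h i) =
        (tensorKernel N E' F').of (∑ i, (tensorAlg u v (d i)) ⊗ₜ[ℂ] h i) := by simp [map_sum]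
    have h1 := (tensorKernel N E F).norm_sq_of_sum d h
    have h2 := (tensorKernel N E' F').norm_sq_of_sum (fun i => tensorAlg u v (d i)) h
    simp only [tensorKernel_apply, tensorInner_tensorAlg] at h1 h2
    have h4 := h2.trans h1.symm
    rw [h0, one_mul]
    have h5 : ‖(tensorKernel N E' F').of (∑ i, (tensorAlg u v (d i)) ⊗ₜ[ℂ] h i)‖ ^ 2 =
        ‖(tensorKernel N E F).of (∑ i, d i ⊗ₜ[ℂ] h i)‖ ^ 2 := by exact_mod_cast h4
    exact (sq_eq_sq₀ (norm_nonneg _) (norm_nonneg _)).1 h5)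

theorem tensorHilb_t3 (u : CorrIso N E E') (v : CorrIso N F F') (x : E) (y : F) (h : H) :
    tensorHilb u v (t3 N x y h) = t3 N (u.toLinearEquiv x) (v.toLinearEquiv y) h :=
  PosKernel.lift_of _ _ _ _

theorem tensorHilb_creation (u : CorrIso N E E') (v : CorrIso N F F') (d : E ⊗[ℂ] F) :
    tensorHilb u v ∘L (tensorKernel N E F).creation d =
      (tensorKernel N E' F').creation (tensorAlg u v d) := by
  ext1 h
  exact PosKernel.lift_of _ _ _ _

theorem tensorHilb_comp_mem (u : CorrIso N E E') (v : CorrIso N F F')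
    {T : H →L[ℂ] TensorSpace N E F} (hT : T ∈ wTensor N E F) :
    tensorHilb u v ∘L T ∈ wTensor N E' F' :=
  wTensor_comp_mem N (tensorHilb u v)
    (fun d => by rw [tensorHilb_creation]; exact creation_mem N _) hT

theorem tensorHilb_symm_comp (u : CorrIso N E E') (v : CorrIso N F F') :
    tensorHilb u.symm v.symm ∘L tensorHilb u v = ContinuousLinearMap.id ℂ _ :=
  ext_t3 N fun x y h => by
    rw [ContinuousLinearMap.comp_apply, tensorHilb_t3, tensorHilb_t3]
    change t3 N (u.toLinearEquiv.symm (u.toLinearEquiv x))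
      (v.toLinearEquiv.symm (v.toLinearEquiv y)) h = t3 N x y h
    rw [LinearEquiv.symm_apply_apply, LinearEquiv.symm_apply_apply]

theorem tensorHilb_comp_symm (u : CorrIso N E E') (v : CorrIso N F F') :
    tensorHilb u v ∘L tensorHilb u.symm v.symm = ContinuousLinearMap.id ℂ _ :=
  tensorHilb_symm_comp u.symm v.symm

theorem adjoint_tensorHilb_comp (u : CorrIso N E E') (v : CorrIso N F F') :
    ContinuousLinearMap.adjoint (tensorHilb u v) ∘L tensorHilb u v =
      ContinuousLinearMap.id ℂ _ :=
  ext_t3 N fun x y h => ext_inner_t3 N fun x' y' h' => by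
    rw [ContinuousLinearMap.comp_apply, ContinuousLinearMap.adjoint_inner_right, tensorHilb_t3,
      tensorHilb_t3, inner_t3, u.map_inner, ← v.map_lact, v.map_inner, ← inner_t3]
    rfl

/-- The isomorphism `u ⊗ v` of `W*`-tensor products induced by isomorphisms `u` and `v` of
correspondences. -/
def tensor (u : CorrIso N E E') (v : CorrIso N F F') :
    CorrIso N (wTensor N E F) (wTensor N E' F') where
  toFun T := ⟨tensorHilb u v ∘L T.1, tensorHilb_comp_mem u v T.2⟩
  invFun T := ⟨tensorHilb u.symm v.symm ∘L T.1, tensorHilb_comp_mem u.symm v.symm T.2⟩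
  map_add' S T := Subtype.ext (ContinuousLinearMap.comp_add _ S.1 T.1)
  map_smul' c T := Subtype.ext (ContinuousLinearMap.comp_smul _ c T.1)
  left_inv T := Subtype.ext (by
    change tensorHilb u.symm v.symm ∘L (tensorHilb u v ∘L T.1) = T.1
    rw [← ContinuousLinearMap.comp_assoc, tensorHilb_symm_comp, ContinuousLinearMap.id_comp])
  right_inv T := Subtype.ext (by
    change tensorHilb u v ∘L (tensorHilb u.symm v.symm ∘L T.1) = T.1
    rw [← ContinuousLinearMap.comp_assoc, tensorHilb_comp_symm, ContinuousLinearMap.id_comp])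
  map_lact a T := Subtype.ext (by
    have h1 : tensorHilb u v ∘L tensorLeft N E F a = tensorLeft N E' F' a ∘L tensorHilb u v :=
      ext_t3 N fun x y h => by
        change tensorHilb u v (tensorLeftMul N a (t3 N x y h)) =
          tensorLeftMul N a (tensorHilb u v (t3 N x y h))
        rw [tensorLeftMul_t3, tensorHilb_t3, tensorHilb_t3, tensorLeftMul_t3, u.map_lact]
    change tensorHilb u v ∘L (tensorLeft N E F a ∘L T.1) =
      tensorLeft N E' F' a ∘L (tensorHilb u v ∘L T.1)
    rw [← ContinuousLinearMap.comp_assoc, h1, ContinuousLinearMap.comp_assoc])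
  map_ract a T := rfl
  map_inner S T := Subtype.ext (by
    change ContinuousLinearMap.adjoint (tensorHilb u v ∘L S.1) ∘L (tensorHilb u v ∘L T.1) =
      ContinuousLinearMap.adjoint S.1 ∘L T.1
    rw [ContinuousLinearMap.adjoint_comp, ContinuousLinearMap.comp_assoc,
      ← ContinuousLinearMap.comp_assoc (ContinuousLinearMap.adjoint (tensorHilb u v)),
      adjoint_tensorHilb_comp, ContinuousLinearMap.id_comp])

theorem tensor_wtmul (u : CorrIso N E E') (v : CorrIso N F F') (x : E) (y : F) :
    (tensor u v).toLinearEquiv (wtmul N x y) =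
      wtmul N (u.toLinearEquiv x) (v.toLinearEquiv y) :=
  Subtype.ext (tensorHilb_creation u v (x ⊗ₜ y))

end CorrIso

end ArvesonCorr

end

open ArvesonCorr

/-!
Everything rests on the operator `Θ : L_P ⊗ L_Q ⊗ H → M ⊗_Q M ⊗_P H` (`NormalUCP.theta`),
`X ⊗ Y ⊗ h ↦ (I ⊗ X) Y h`. It is isometric, because `(I ⊗ X)* (I ⊗ X') = I ⊗ X* X'` is the left
action of `⟨X, X'⟩` (`NormalUCP.inner_psiOp`), and `Ψ` is composition with `Θ`. That this is onto
has two ingredients.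

* `Θ` is surjective. Since `P` is normal, the vector functional of `I ⊗ h ∈ M ⊗_P H` is
  `T ↦ ∑ ⟨a n, T (b n)⟩`, hence dominated by the vector functional of a sequence `c ∈ ℓ²(H)`. So
  `T c ↦ T ⊗ h` extends to a bounded intertwiner `ℓ²(H) → M ⊗_P H`, whose restrictions to the
  summands are in `L_P`. Therefore the vectors `X h` with `X ∈ L_P` are total in `M ⊗_P H`
  (`NormalUCP.rangeSpan_intertwiners`), and so are the vectors `(I ⊗ X) Y h` in
  `M ⊗_Q M ⊗_P H` (`NormalUCP.rangeSpan_psiLin`).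
* A right `M'`-invariant space of intertwiners whose ranges are total is dense in `L_M(H, K)` for
  the strong operator topology (`mem_closure_of_rangeSpan_eq_top`). This is a double commutant argument
  on finite direct sums: the projection onto the closure of `{(R (x i)) | R ∈ M'}` is a matrix over
  `M`, and every intertwiner commutes with it. So `Θ* Z` is in the strong closure that
  defines `L_P ⊗ L_Q`, for every `Z ∈ L_M(H, M ⊗_Q M ⊗_P H)`.

The operator `V₀` is isometric with range `M ⊗_Q I ⊗_P H`, which gives the claims on `V`. The
multiplication map is `U_{PQ}⁻¹ V* Ψ (U_P ⊗ U_Q)`; it takes `Y ⊗ Z` to `Y Z` because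
`Φ_Z (I ⊗ Φ_Y) V₀ (I ⊗ h) = Z* Y* h`, and it is coisometric because `V* V = I`. Both `Ψ` and `m` are
determined by their values on elementary tensors, since an element of a `W*`-tensor product is
determined by its inner products with these (`wTensor_ext`).
-/

noncomputable section

namespace ArvesonCorr

/-! ### Extension of intertwiners from cyclic subspaces -/

section HilbertSpace

variable {L : Type*} [NormedAddCommGroup L] [InnerProductSpace ℂ L]

theorem map_mem_topologicalClosure {S : Submodule ℂ L} {D : L →L[ℂ] L}
    (hD : ∀ x ∈ S, D x ∈ S) : ∀ x ∈ S.topologicalClosure, D x ∈ S.topologicalClosure :=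
  fun _ hx => map_mem_closure D.continuous hx hD

variable [CompleteSpace L]

/-- The projection onto a subspace that is invariant under an operator and its adjoint commutes
with the operator. -/
theorem starProjection_apply_comm (S : Submodule ℂ L) [S.HasOrthogonalProjection] {D : L →L[ℂ] L}
    (hD : ∀ x ∈ S, D x ∈ S) (hD' : ∀ x ∈ S, ContinuousLinearMap.adjoint D x ∈ S) (x : L) :
    S.starProjection (D x) = D (S.starProjection x) := by
  refine Submodule.eq_starProjection_of_mem_orthogonal (hD _ (S.starProjection_apply_mem x)) ?_
  rw [← map_sub, Submodule.mem_orthogonal]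
  intro u hu
  rw [← ContinuousLinearMap.adjoint_inner_left]
  exact (Submodule.mem_orthogonal _ _).1 (S.sub_starProjection_mem_orthogonal x) _ (hD' u hu)

/-- If `‖ρ(a) k‖ ≤ ‖σ(a) ξ‖` for all `a`, then `σ(a) ξ ↦ ρ(a) k` extends to a bounded intertwiner:
by continuity to the cyclic subspace of `ξ`, and by zero to its orthogonal complement. -/
theorem exists_intertwiner_of_norm_le {A : Type*} [Ring A] [StarRing A] [Algebra ℂ A]
    {K : Type*} [NormedAddCommGroup K] [InnerProductSpace ℂ K] [CompleteSpace K]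
    (σ : A →⋆ₐ[ℂ] (L →L[ℂ] L)) (ρ : A →⋆ₐ[ℂ] (K →L[ℂ] K)) (ξ : L) (k : K)
    (hle : ∀ a, ‖ρ a k‖ ≤ ‖σ a ξ‖) :
    ∃ X : L →L[ℂ] K, X ξ = k ∧ ∀ a x, X (σ a x) = ρ a (X x) := by
  let f : A →ₗ[ℂ] L :=
    { toFun := fun a => σ a ξ
      map_add' := fun a b => by simp
      map_smul' := fun c a => by simp }
  let g : A →ₗ[ℂ] K :=
    { toFun := fun a => ρ a k
      map_add' := fun a b => by simp
      map_smul' := fun c a => by simp }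
  let S : Submodule ℂ L := (LinearMap.range f).topologicalClosure
  have hfS : ∀ a, f a ∈ S := fun a => subset_closure ⟨a, rfl⟩
  let e : A →ₗ[ℂ] S := f.codRestrict S hfS
  have he : DenseRange e := by
    intro x
    rw [closure_subtype]
    have h1 : (Subtype.val '' Set.range e : Set L) = Set.range f := by
      rw [← Set.range_comp]; rfl
    rw [h1]
    exact x.2
  have hb : ∃ C : ℝ, ∀ a, ‖g a‖ ≤ C * ‖e a‖ := ⟨1, fun a => by rw [one_mul]; exact hle a⟩
  let X₀ : S →L[ℂ] K := g.extendOfNorm e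
  have hX₀ : ∀ a, X₀ (e a) = ρ a k := fun a => LinearMap.extendOfNorm_eq he hb a
  have : CompleteSpace S := (Submodule.isClosed_topologicalClosure _).completeSpace_coe
  let X : L →L[ℂ] K := X₀ ∘L S.orthogonalProjectionOnto
  have hX : ∀ (x : L) (s : S), S.starProjection x = s → X x = X₀ s := by
    intro x s hs
    change X₀ (S.orthogonalProjectionOnto x) = X₀ s
    congr 1
    exact Subtype.ext hs
  have hXf : ∀ a, X (f a) = ρ a k := fun a => by
    rw [hX (f a) (e a) (Submodule.starProjection_eq_self_iff.2 (hfS a)), hX₀]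
  have hinv : ∀ a, ∀ x ∈ S, σ a x ∈ S := fun a => map_mem_topologicalClosure (by
    rintro _ ⟨b, rfl⟩
    exact ⟨a * b, by simp [f]⟩)
  refine ⟨X, ?_, fun a x => ?_⟩
  · have := hXf 1
    simpa [f] using this
  · have h1 : ∀ x ∈ S, X (σ a x) = ρ a (X x) := by
      refine fun x hx => closure_minimal (t := {x | X (σ a x) = ρ a (X x)}) ?_
        (isClosed_eq (by fun_prop) (by fun_prop)) hx
      rintro _ ⟨b, rfl⟩
      have h2 := hXf (a * b)
      have h3 : f (a * b) = σ a (f b) := by simp [f]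
      rw [h3] at h2
      change X (σ a (f b)) = ρ a (X (f b))
      rw [h2, hXf, map_mul]; rfl
    have h4 : ∀ y, X y = X (S.starProjection y) := fun y => by
      rw [hX y ⟨_, S.starProjection_apply_mem y⟩ rfl]
      refine (hX _ _ ?_).symm
      exact Submodule.starProjection_eq_self_iff.2 (S.starProjection_apply_mem y)
    rw [h4 (σ a x), starProjection_apply_comm S (hinv a) (by
      rw [← ContinuousLinearMap.star_eq_adjoint, ← map_star]; exact hinv (star a)),
      h1 _ (S.starProjection_apply_mem x), ← h4]

end HilbertSpace

/-! ### Composition with bounded operators -/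

section Composition

variable {H K L : Type*} [NormedAddCommGroup H] [InnerProductSpace ℂ H]
  [NormedAddCommGroup K] [InnerProductSpace ℂ K] [NormedAddCommGroup L] [InnerProductSpace ℂ L]

theorem comp_mem_closure {α : Type*} (A : K →L[ℂ] L) {s : Set (α → K)} {t : Set (α → L)}
    (hst : ∀ f ∈ s, (fun h => A (f h)) ∈ t) {f : α → K} (hf : f ∈ closure s) :
    (fun h => A (f h)) ∈ closure t :=
  map_mem_closure (f := fun f : α → K => fun h => A (f h)) (by fun_prop) hf hst

theorem comp_comp_of_comp_eq_id {A : L →L[ℂ] K} {B : K →L[ℂ] L}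
    (h : A ∘L B = ContinuousLinearMap.id ℂ K) (T : H →L[ℂ] K) : A ∘L (B ∘L T) = T := by
  rw [← ContinuousLinearMap.comp_assoc, h, ContinuousLinearMap.id_comp]

theorem adjoint_comp_comp_of_isometry [CompleteSpace H] [CompleteSpace K] [CompleteSpace L]
    {A : K →L[ℂ] L} (h : ContinuousLinearMap.adjoint A ∘L A = ContinuousLinearMap.id ℂ K)
    (S T : H →L[ℂ] K) : ContinuousLinearMap.adjoint (A ∘L S) ∘L (A ∘L T) =
      ContinuousLinearMap.adjoint S ∘L T := by
  rw [ContinuousLinearMap.adjoint_comp, ContinuousLinearMap.comp_assoc,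
    comp_comp_of_comp_eq_id h]

end Composition

/-! ### Countable multiples of the identity representation -/

section Amplification

variable {H : Type*} [NormedAddCommGroup H]

/-- The Hilbert sum of countably many copies of `H`. -/
abbrev Ell2 (H : Type*) [NormedAddCommGroup H] : Type _ := lp (fun _ : ℕ => H) 2

theorem memℓp_two_of_summable {c : ℕ → H} (hc : Summable fun n => ‖c n‖ ^ 2) :
    Memℓp (E := fun _ : ℕ => H) c 2 :=
  memℓp_gen (by simpa using hc)

theorem ell2_hasSum_norm_sq (x : Ell2 H) : HasSum (fun n => ‖x n‖ ^ 2) (‖x‖ ^ 2) := by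
  simpa using lp.hasSum_norm (p := 2) (by simp) x

variable [InnerProductSpace ℂ H]

theorem summable_norm_sq_apply (T : H →L[ℂ] H) {c : ℕ → H} (hc : Summable fun n => ‖c n‖ ^ 2) :
    Summable fun n => ‖T (c n)‖ ^ 2 :=
  (hc.mul_left (‖T‖ ^ 2)).of_nonneg_of_le (fun _ => by positivity) fun n => by
    rw [← mul_pow]; gcongr; exact T.le_opNorm _

/-- The operator `(x n) ↦ (T (x n))`. -/
def ampOp (T : H →L[ℂ] H) : Ell2 H →L[ℂ] Ell2 H :=
  LinearMap.mkContinuous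
    { toFun := fun x => ⟨fun n => T (x n),
        memℓp_two_of_summable (summable_norm_sq_apply T (ell2_hasSum_norm_sq x).summable)⟩
      map_add' := fun x y => by ext n; exact map_add T _ _
      map_smul' := fun c x => by ext n; exact map_smul T _ _ } ‖T‖ (fun x => by
    refine le_of_sq_le_sq ?_ (by positivity)
    rw [mul_pow]
    refine hasSum_le (fun n => ?_) (ell2_hasSum_norm_sq _)
      ((ell2_hasSum_norm_sq x).mul_left (‖T‖ ^ 2))
    rw [← mul_pow]; gcongr; exact T.le_opNorm _)

theorem ampOp_apply (T : H →L[ℂ] H) (x : Ell2 H) (n : ℕ) : ampOp T x n = T (x n) := rfl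

variable [CompleteSpace H]

/-- The representation of `B(H)` on the Hilbert sum of copies of `H`. -/
def amp : (H →L[ℂ] H) →⋆ₐ[ℂ] (Ell2 H →L[ℂ] Ell2 H) where
  toFun := ampOp
  map_one' := by ext x n; rfl
  map_mul' a b := by ext x n; rfl
  map_zero' := by ext x n; rfl
  map_add' a b := by ext x n; rfl
  commutes' c := by ext x n; rfl
  map_star' a := by
    ext1 x
    refine ext_inner_left ℂ fun y => ?_
    rw [ContinuousLinearMap.star_eq_adjoint (ampOp a), ContinuousLinearMap.adjoint_inner_right]
    refine (lp.hasSum_inner y (ampOp (star a) x)).unique ?_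
    refine (lp.hasSum_inner (ampOp a y) x).congr_fun fun n => ?_
    rw [ampOp_apply, ampOp_apply, ContinuousLinearMap.star_eq_adjoint,
      ContinuousLinearMap.adjoint_inner_right]

end Amplification

/-! ### Normal representations are spanned by the ranges of intertwiners -/

section Total

variable {H : Type*} [NormedAddCommGroup H] [InnerProductSpace ℂ H]
variable {K : Type*} [NormedAddCommGroup K] [InnerProductSpace ℂ K]

/-- The closed linear span of the ranges of the operators in `E`. -/
def rangeSpan (E : Submodule ℂ (H →L[ℂ] K)) : Submodule ℂ K :=
  (Submodule.span ℂ {k | ∃ X ∈ E, ∃ h, X h = k}).topologicalClosure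

theorem apply_mem_rangeSpan {E : Submodule ℂ (H →L[ℂ] K)} {X : H →L[ℂ] K} (hX : X ∈ E) (h : H) :
    X h ∈ rangeSpan E :=
  subset_closure (Submodule.subset_span ⟨X, hX, h, rfl⟩)

theorem map_mem_of_rangeSpan_eq_top {E : Submodule ℂ (H →L[ℂ] K)} (hE : rangeSpan E = ⊤)
    {L : Type*} [NormedAddCommGroup L] [InnerProductSpace ℂ L] {G : Submodule ℂ L}
    (hG : IsClosed (G : Set L)) (f : K →L[ℂ] L) (hf : ∀ X ∈ E, ∀ h, f (X h) ∈ G) (k : K) :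
    f k ∈ G := by
  have h1 : rangeSpan E ≤ G.comap f.toLinearMap := by
    refine Submodule.topologicalClosure_minimal _ (Submodule.span_le.2 ?_)
      (hG.preimage f.continuous)
    rintro _ ⟨X, hX, h, rfl⟩
    exact hf X hX h
  rw [hE] at h1
  exact h1 trivial

theorem eq_zero_of_rangeSpan_eq_top {E : Submodule ℂ (H →L[ℂ] K)} (hE : rangeSpan E = ⊤) {k : K}
    (hk : ∀ X ∈ E, ∀ h, ⟪X h, k⟫_ℂ = 0) : k = 0 := by
  have h1 : k ∈ (Submodule.span ℂ {k | ∃ X ∈ E, ∃ h, X h = k})ᗮ := by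
    rw [Submodule.mem_orthogonal]
    intro u hu
    induction hu using Submodule.span_induction with
    | mem x hx => obtain ⟨X, hX, h, rfl⟩ := hx; exact hk X hX h
    | zero => simp
    | add x y _ _ hx hy => rw [inner_add_left, hx, hy, add_zero]
    | smul c x _ hx => rw [inner_smul_left, hx, mul_zero]
  rw [← Submodule.orthogonal_closure] at h1
  change k ∈ (rangeSpan E)ᗮ at h1
  rw [hE, Submodule.top_orthogonal_eq_bot] at h1
  exact (Submodule.mem_bot ℂ).1 h1

variable [CompleteSpace K]

/-- An isometry whose range contains the ranges of a total family of operators is unitary. -/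
theorem comp_adjoint_of_rangeSpan_eq_top {L : Type*} [NormedAddCommGroup L]
    [InnerProductSpace ℂ L] [CompleteSpace L] {E : Submodule ℂ (H →L[ℂ] K)}
    (hE : rangeSpan E = ⊤) (A : L →L[ℂ] K)
    (hA : ContinuousLinearMap.adjoint A ∘L A = ContinuousLinearMap.id ℂ L)
    (hr : ∀ X ∈ E, ∃ T : H →L[ℂ] L, A ∘L T = X) :
    A ∘L ContinuousLinearMap.adjoint A = ContinuousLinearMap.id ℂ K := by
  ext1 y
  rw [← sub_eq_zero]
  refine eq_zero_of_rangeSpan_eq_top hE fun X hX h => ?_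
  obtain ⟨T, rfl⟩ := hr X hX
  have h1 : ContinuousLinearMap.adjoint A (A (ContinuousLinearMap.adjoint A y)) =
      ContinuousLinearMap.adjoint A y := congrArg (fun T => T (ContinuousLinearMap.adjoint A y)) hA
  rw [ContinuousLinearMap.comp_apply, ← ContinuousLinearMap.adjoint_inner_right, map_sub,
    ContinuousLinearMap.comp_apply, h1, ContinuousLinearMap.id_apply, sub_self, inner_zero_right]

variable [CompleteSpace H] {M : VonNeumannAlgebra H}

/-- A vector whose vector functional is dominated by one of the form `T ↦ ∑ n, ⟨c n, T (c n)⟩`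
lies in the closed span of the ranges of the intertwiners: it is `X c` for an intertwiner `X` from
a multiple of the identity representation, and the restrictions of `X` to the summands belong to
`L_M(H, K)`. -/
theorem mem_rangeSpan_intertwiners (ρ : BiRep M K) (k : K) (c : ℕ → H)
    (hc : Summable fun n => ‖c n‖ ^ 2)
    (hle : ∀ T : El M, ‖ρ.left T k‖ ^ 2 ≤ ∑' n, ‖(T : H →L[ℂ] H) (c n)‖ ^ 2) :
    k ∈ rangeSpan ρ.intertwiners := by
  let ξ : Ell2 H := ⟨c, memℓp_two_of_summable hc⟩
  let σ : El M →⋆ₐ[ℂ] (Ell2 H →L[ℂ] Ell2 H) := amp.comp M.toStarSubalgebra.subtype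
  obtain ⟨X, hXk, hX⟩ := exists_intertwiner_of_norm_le σ ρ.left ξ k fun T => by
    refine le_of_sq_le_sq ((hle T).trans_eq ?_) (norm_nonneg _)
    exact (ell2_hasSum_norm_sq (σ T ξ)).tsum_eq
  let ι : ℕ → H →L[ℂ] Ell2 H := fun n => lp.singleContinuousLinearMap ℂ (fun _ : ℕ => H) 2 n
  have hι : ∀ n (T : El M) h, ι n ((T : H →L[ℂ] H) h) = σ T (ι n h) := by
    intro n T h
    ext m
    change (lp.single 2 n ((T : H →L[ℂ] H) h) : Ell2 H) m =
      (T : H →L[ℂ] H) ((lp.single 2 n h : Ell2 H) m)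
    rw [lp.single_apply, lp.single_apply]
    by_cases hm : m = n
    · subst hm; simp
    · simp [hm]
  have hmem : ∀ n, X ∘L ι n ∈ ρ.intertwiners := fun n T => by
    ext h
    change X (ι n ((T : H →L[ℂ] H) h)) = ρ.left T (X (ι n h))
    rw [hι, hX]
  have hsum : HasSum (fun n => X (ι n (c n))) (X ξ) :=
    (lp.hasSum_single (p := 2) (by simp) ξ).mapL X
  rw [← hXk]
  exact (Submodule.isClosed_topologicalClosure _).mem_of_tendsto hsum
    (Filter.Eventually.of_forall fun s =>
      Submodule.sum_mem _ fun n _ => apply_mem_rangeSpan (hmem n) (c n))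

/-- A strong limit of intertwiners is an intertwiner. -/
theorem mem_intertwiners_of_mem_closure (ρ : BiRep M K) {s : Set (H → K)}
    (hs : ∀ f ∈ s, ∀ (S : El M) h, f ((S : H →L[ℂ] H) h) = ρ.left S (f h)) {X : H →L[ℂ] K}
    (hX : (X : H → K) ∈ closure s) : X ∈ ρ.intertwiners := by
  intro S
  ext h
  exact closure_minimal (t := {f : H → K | f ((S : H →L[ℂ] H) h) = ρ.left S (f h)})
    (fun f hf => hs f hf S h) (isClosed_eq (by fun_prop) (by fun_prop)) hX

namespace NormalUCP

/-- Normality of `P` makes the vector functional of `I ⊗ h` dominated by a functional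
`T ↦ ∑ n, ⟨c n, T (c n)⟩`. -/
theorem exists_dominating (P : NormalUCP M) (h : H) : ∃ c : ℕ → H, (Summable fun n => ‖c n‖ ^ 2) ∧
    ∀ T : El M, ‖P.elem (stdRep M) T h‖ ^ 2 ≤ ∑' n, ‖(T : H →L[ℂ] H) (c n)‖ ^ 2 := by
  let f : El M →ₗ[ℂ] ℂ :=
    { toFun := fun T => ⟪h, (T : H →L[ℂ] H) h⟫_ℂ
      map_add' := fun S T => by simp
      map_smul' := fun a T => by simp }
  have hf : IsSigmaWeak M f := by
    have h0 : Summable fun n : ℕ => ‖if n = 0 then h else 0‖ ^ 2 :=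
      summable_of_ne_finset_zero (s := {0}) fun n hn => by simp_all
    refine ⟨fun n => if n = 0 then h else 0, fun n => if n = 0 then h else 0, h0, h0, fun T => ?_⟩
    have := hasSum_single (f := fun n : ℕ => ⟪if n = 0 then h else 0,
      (T : H →L[ℂ] H) (if n = 0 then h else 0)⟫_ℂ) 0 fun n hn => by simp [hn]
    simpa [f] using this
  obtain ⟨a, b, ha, hb, hab⟩ := P.normal f hf
  have hc : Summable fun n => ‖(2⁻¹ : ℂ) • (a n + b n)‖ ^ 2 := by
    refine (ha.add hb).of_nonneg_of_le (fun _ => by positivity) fun n => ?_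
    have h1 := parallelogram_law_with_norm ℂ (a n) (b n)
    rw [norm_smul, mul_pow]
    norm_num
    nlinarith [norm_nonneg (a n - b n), norm_nonneg (a n + b n)]
  refine ⟨fun n => (2⁻¹ : ℂ) • (a n + b n), hc, fun T => ?_⟩
  have h1 : ((‖P.elem (stdRep M) T h‖ ^ 2 : ℝ) : ℂ) = f (P.map (star T * T)) := by
    have h2 := P.inner_elem (stdRep M) T T h h
    rw [inner_self_eq_norm_sq_to_K] at h2
    exact_mod_cast h2
  have h2 := Complex.hasSum_re (hab (star T * T))
  have h3 : ‖P.elem (stdRep M) T h‖ ^ 2 = ((f ∘ₗ P.map) (star T * T)).re := by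
    rw [LinearMap.comp_apply, ← h1, Complex.ofReal_re]
  rw [h3]
  refine hasSum_le (fun n => ?_) h2
    (summable_norm_sq_apply (T : H →L[ℂ] H) hc).hasSum
  have h4 : ⟪a n, ((star T * T : El M) : H →L[ℂ] H) (b n)⟫_ℂ =
      ⟪(T : H →L[ℂ] H) (a n), (T : H →L[ℂ] H) (b n)⟫_ℂ := by
    rw [MulMemClass.coe_mul, StarMemClass.coe_star, mul_apply_eq_comp,
      ContinuousLinearMap.star_eq_adjoint, ContinuousLinearMap.adjoint_inner_right]
  rw [h4, map_smul, map_add, norm_smul, mul_pow]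
  -- `Re ⟨x, y⟩ ≤ ‖(x + y) / 2‖²` by polarization
  have h5 := @norm_add_sq ℂ _ _ _ _ ((T : H →L[ℂ] H) (a n)) ((T : H →L[ℂ] H) (b n))
  have h6 := @norm_sub_sq ℂ _ _ _ _ ((T : H →L[ℂ] H) (a n)) ((T : H →L[ℂ] H) (b n))
  simp only [RCLike.re_to_complex] at h5 h6
  norm_num
  nlinarith [sq_nonneg ‖(T : H →L[ℂ] H) (a n) - (T : H →L[ℂ] H) (b n)‖]

theorem rangeSpan_intertwiners (P : NormalUCP M) :
    rangeSpan (P.dil (stdRep M)).intertwiners = ⊤ := by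
  set G := rangeSpan (P.dil (stdRep M)).intertwiners with hG
  have hone : ∀ h, P.elem (stdRep M) 1 h ∈ G := by
    intro h
    obtain ⟨c, hc, hle⟩ := P.exists_dominating h
    refine mem_rangeSpan_intertwiners _ _ c hc fun T => ?_
    rw [dil_left_elem, mul_one]
    exact hle T
  have hinv : ∀ S : El M, ∀ x ∈ G, (P.dil (stdRep M)).left S x ∈ G := fun S =>
    map_mem_topologicalClosure fun x hx => by
      induction hx using Submodule.span_induction with
      | mem x hx =>
        obtain ⟨X, hX, h, rfl⟩ := hx
        exact Submodule.subset_span ⟨X, hX, (S : H →L[ℂ] H) h, hX.apply S h⟩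
      | zero => rw [map_zero]; exact Submodule.zero_mem _
      | add x y _ _ hx hy => rw [map_add]; exact Submodule.add_mem _ hx hy
      | smul c x _ hx => rw [map_smul]; exact Submodule.smul_mem _ c hx
  have helem : ∀ S h, P.elem (stdRep M) S h ∈ G := fun S h => by
    have := hinv S _ (hone h)
    rwa [dil_left_elem, mul_one] at this
  refine top_le_iff.1 fun x _ => ?_
  refine (P.kernel (stdRep M)).denseRange_of.induction_on (p := fun x => x ∈ G) x
    (Submodule.isClosed_topologicalClosure _) fun z => ?_
  induction z with
  | zero => rw [map_zero]; exact Submodule.zero_mem _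
  | add a b ha hb => rw [map_add]; exact Submodule.add_mem _ ha hb
  | tmul S h => exact helem S h

end NormalUCP

end Total

/-! ### Strong density of total spaces of intertwiners -/

section Density

variable {H : Type*} [NormedAddCommGroup H] [InnerProductSpace ℂ H] [CompleteSpace H]

/-- The projection onto the closure of `{(R (x i))ᵢ | R ∈ N'}` in the direct sum of copies of `H`,
as a self-adjoint matrix over `N`. -/
theorem exists_matrix_projection (N : VonNeumannAlgebra H) {ι : Type*} [Fintype ι] (x : ι → H) :
    ∃ q : ι → ι → El N, (∀ i j, star (q i j) = q j i) ∧
      (∀ i, ∑ j, (q i j : H →L[ℂ] H) (x j) = x i) ∧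
      ∀ v : ι → H, (∀ R : El N.commutant, ∑ i, ⟪(R : H →L[ℂ] H) (x i), v i⟫_ℂ = 0) →
        ∀ i, ∑ j, (q i j : H →L[ℂ] H) (v j) = 0 := by
  classical
  let p : ι → (PiLp 2 (fun _ : ι => H) →L[ℂ] H) := fun i => PiLp.proj 2 (fun _ : ι => H) i
  let e : ι → (H →L[ℂ] PiLp 2 (fun _ : ι => H)) := fun i => ContinuousLinearMap.adjoint (p i)
  have he : ∀ i h, e i h = PiLp.single 2 i h := by
    intro i h
    refine ext_inner_left ℂ fun v => ?_
    rw [ContinuousLinearMap.adjoint_inner_right, PiLp.inner_apply, Finset.sum_eq_single i] <;>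
      simp +contextual [p]
  have hsum : ∀ y, ∑ k, e k (p k y) = y := by
    intro y
    ext j
    simp [he, p]
  let D : (H →L[ℂ] H) → PiLp 2 (fun _ : ι => H) →L[ℂ] PiLp 2 (fun _ : ι => H) := fun T =>
    ∑ k, e k ∘L T ∘L p k
  have hpD : ∀ T i y, p i (D T y) = T (p i y) := by
    intro T i y
    have : ∀ k h, p i (e k h) = if i = k then h else 0 := fun k h => by
      rw [he]; simp [p]
    simp [D, this]
  have hDe : ∀ T j h, D T (e j h) = e j (T h) := by
    intro T j h
    ext i
    change p i (D T (e j h)) = p i (e j (T h))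
    rw [hpD, he, he]
    by_cases hij : i = j
    · subst hij; simp [p]
    · simp [p, hij]
  have hDadj : ∀ T, ContinuousLinearMap.adjoint (D T) = D (star T) := by
    intro T
    refine ((ContinuousLinearMap.eq_adjoint_iff _ _).2 fun y z => ?_).symm
    simp only [PiLp.inner_apply]
    refine Finset.sum_congr rfl fun i _ => ?_
    change ⟪p i (D (star T) y), p i z⟫_ℂ = ⟪p i y, p i (D T z)⟫_ℂ
    rw [hpD, hpD, ContinuousLinearMap.star_eq_adjoint, ContinuousLinearMap.adjoint_inner_left]
  let r : El N.commutant →ₗ[ℂ] PiLp 2 (fun _ : ι => H) :=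
    { toFun := fun R => WithLp.toLp 2 fun i => (R : H →L[ℂ] H) (x i)
      map_add' := fun R R' => rfl
      map_smul' := fun c R => rfl }
  have hpr : ∀ R i, p i (r R) = (R : H →L[ℂ] H) (x i) := fun R i => rfl
  let S := (LinearMap.range r).topologicalClosure
  have : CompleteSpace S := (Submodule.isClosed_topologicalClosure _).completeSpace_coe
  let B := S.starProjection
  have hinv : ∀ R : El N.commutant, ∀ y ∈ S, D (R : H →L[ℂ] H) y ∈ S := fun R =>
    map_mem_topologicalClosure (by
      rintro _ ⟨R', rfl⟩
      refine ⟨R * R', ?_⟩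
      ext i
      exact (hpD _ i (r R')).symm)
  have hBD : ∀ (R : El N.commutant) y, B (D (R : H →L[ℂ] H) y) = D (R : H →L[ℂ] H) (B y) :=
    fun R => starProjection_apply_comm S (hinv R) (by rw [hDadj]; exact hinv (star R))
  have hmem : ∀ i j, p i ∘L B ∘L e j ∈ N := by
    intro i j
    rw [← VonNeumannAlgebra.commutant_commutant N, VonNeumannAlgebra.mem_commutant_iff]
    intro R hR
    ext h
    change R (p i (B (e j h))) = p i (B (e j (R h)))
    rw [← hDe R, hBD ⟨R, hR⟩, hpD]
  have hq : ∀ i (v : ι → H), ∑ j, (p i ∘L B ∘L e j) (v j) = p i (B (WithLp.toLp 2 v)) := by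
    intro i v
    conv_rhs => rw [← hsum (WithLp.toLp 2 v), map_sum, map_sum]
    rfl
  refine ⟨fun i j => ⟨p i ∘L B ∘L e j, hmem i j⟩, fun i j => Subtype.ext ?_, fun i => ?_,
    fun v hv i => ?_⟩
  · change ContinuousLinearMap.adjoint (p i ∘L B ∘L e j) = p j ∘L B ∘L e i
    rw [ContinuousLinearMap.adjoint_comp, ContinuousLinearMap.adjoint_comp,
      ContinuousLinearMap.adjoint_adjoint, ContinuousLinearMap.comp_assoc,
      isSelfAdjoint_starProjection S |>.adjoint_eq]
  · refine (hq i x).trans ?_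
    have h1 : WithLp.toLp 2 x ∈ S := subset_closure ⟨1, rfl⟩
    rw [Submodule.starProjection_eq_self_iff.2 h1]
    rfl
  · refine (hq i v).trans ?_
    have h1 : WithLp.toLp 2 v ∈ Sᗮ := by
      rw [Submodule.orthogonal_closure, Submodule.mem_orthogonal]
      rintro _ ⟨R, rfl⟩
      rw [PiLp.inner_apply]
      exact hv R
    rw [(Submodule.starProjection_apply_eq_zero_iff S).2 h1, map_zero]

variable {M : VonNeumannAlgebra H}
variable {K : Type*} [NormedAddCommGroup K] [InnerProductSpace ℂ K] [CompleteSpace K]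

/-- On finitely many vectors, every intertwiner can be approximated by elements of a right
`M'`-invariant space of intertwiners whose ranges are total. If `(k i)` is orthogonal to
`{(X (x i)) | X ∈ E}`, then each `(X* (k i))` is orthogonal to `{(R (x i)) | R ∈ M'}`, hence
annihilated by the projection `q` onto the closure of that space; as `q` has entries in `M` and `E`
is total, `π(q)` annihilates `(k i)`, which is therefore orthogonal to `(Z (x i)) = π(q) (Z (x i))`.
-/
theorem mem_closure_eval_of_rangeSpan_eq_top (ρ : BiRep M K) {E : Submodule ℂ (H →L[ℂ] K)}
    (hE : E ≤ ρ.intertwiners) (hr : ∀ X ∈ E, ∀ R : El M.commutant, X ∘L (R : H →L[ℂ] H) ∈ E)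
    (ht : rangeSpan E = ⊤) {Z : H →L[ℂ] K} (hZ : Z ∈ ρ.intertwiners) {ι : Type*} [Fintype ι]
    (x : ι → H) :
    (WithLp.toLp 2 fun i => Z (x i) : PiLp 2 fun _ : ι => K) ∈
      closure (Set.range fun X : E => (WithLp.toLp 2 fun i => X.1 (x i) : PiLp 2 fun _ : ι => K))
    := by
  let ev : E →ₗ[ℂ] PiLp 2 (fun _ : ι => K) :=
    { toFun := fun X => WithLp.toLp 2 fun i => X.1 (x i)
      map_add' := fun X Y => rfl
      map_smul' := fun c X => rfl }
  change _ ∈ (LinearMap.range ev).topologicalClosure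
  rw [← Submodule.orthogonal_orthogonal_eq_closure, Submodule.mem_orthogonal]
  intro k hk
  rw [Submodule.mem_orthogonal] at hk
  obtain ⟨q, hqs, hqx, hqv⟩ := exists_matrix_projection M x
  have h1 : ∀ i, ∑ j, ρ.left (q i j) (k j) = 0 := by
    intro i
    refine eq_zero_of_rangeSpan_eq_top ht fun X hX h => ?_
    have h2 : ∑ j, (q i j : H →L[ℂ] H) (ContinuousLinearMap.adjoint X (k j)) = 0 := by
      refine hqv _ (fun R => ?_) i
      have h3 := hk _ ⟨⟨_, hr X hX R⟩, rfl⟩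
      rw [PiLp.inner_apply] at h3
      rw [← h3]
      exact Finset.sum_congr rfl fun j _ => ContinuousLinearMap.adjoint_inner_right _ _ _
    rw [← ContinuousLinearMap.adjoint_inner_right, map_sum]
    have h4 : ∀ j, ContinuousLinearMap.adjoint X (ρ.left (q i j) (k j)) =
        (q i j : H →L[ℂ] H) (ContinuousLinearMap.adjoint X (k j)) := fun j =>
      Intertwines.apply (ρ' := stdRep M) (Intertwines.adjoint (hE hX)) (q i j) (k j)
    rw [Finset.sum_congr rfl fun j _ => h4 j, h2, inner_zero_right]
  rw [PiLp.inner_apply]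
  have h5 : ∀ i, ⟪k i, Z (x i)⟫_ℂ = ∑ j, ⟪ρ.left (q j i) (k i), Z (x j)⟫_ℂ := by
    intro i
    conv_lhs => rw [← hqx i, map_sum, inner_sum]
    refine Finset.sum_congr rfl fun j _ => ?_
    have h6 : Z ((q i j : H →L[ℂ] H) (x j)) = ρ.left (q i j) (Z (x j)) :=
      Intertwines.apply (ρ := stdRep M) hZ (q i j) (x j)
    rw [h6, ← hqs j i, map_star, ContinuousLinearMap.star_eq_adjoint,
      ContinuousLinearMap.adjoint_inner_right]
  change ∑ i, ⟪k i, Z (x i)⟫_ℂ = 0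
  rw [Finset.sum_congr rfl fun i _ => h5 i, Finset.sum_comm]
  refine Finset.sum_eq_zero fun j _ => ?_
  rw [← sum_inner, h1, inner_zero_left]

/-- A right `M'`-invariant space of intertwiners whose ranges are total is dense in `L_M(H, K)` for
the strong operator topology. -/
theorem mem_closure_of_rangeSpan_eq_top (ρ : BiRep M K) {E : Submodule ℂ (H →L[ℂ] K)}
    (hE : E ≤ ρ.intertwiners) (hr : ∀ X ∈ E, ∀ R : El M.commutant, X ∘L (R : H →L[ℂ] H) ∈ E)
    (ht : rangeSpan E = ⊤) {Z : H →L[ℂ] K} (hZ : Z ∈ ρ.intertwiners) :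
    (Z : H → K) ∈ closure (Set.range fun X : E => (X.1 : H → K)) := by
  rw [mem_closure_iff_nhds]
  intro t htn
  rw [nhds_pi, Filter.mem_pi'] at htn
  obtain ⟨I, s, hs, hst⟩ := htn
  have h1 := mem_closure_eval_of_rangeSpan_eq_top ρ hE hr ht hZ fun i : I => (i : H)
  rw [mem_closure_iff_nhds] at h1
  have hc : Continuous fun y : PiLp 2 (fun _ : I => K) => fun i => y i := by fun_prop
  obtain ⟨_, hy, X, rfl⟩ := h1 ((fun y : PiLp 2 (fun _ : I => K) => fun i => y i) ⁻¹'
    Set.univ.pi fun i : I => s i) (hc.continuousAt.preimage_mem_nhds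
      (set_pi_mem_nhds Set.finite_univ fun i _ => hs i))
  exact ⟨_, hst fun i hi => hy ⟨i, hi⟩ (Set.mem_univ _), X, rfl⟩

end Density

/-! ### Maps between correspondences -/

section Maps

variable {H : Type*} [NormedAddCommGroup H] [InnerProductSpace ℂ H] [CompleteSpace H]
variable {N : VonNeumannAlgebra H}
variable {E F G : Type*} [AddCommGroup E] [Module ℂ E] [AddCommGroup F] [Module ℂ F]
  [AddCommGroup G] [Module ℂ G] [Correspondence N E] [Correspondence N F] [Correspondence N G]

theorem Correspondence.ext_inner_left {x y : E}
    (h : ∀ z : E, Correspondence.inner (N := N) z x = Correspondence.inner z y) : x = y := by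
  rw [← sub_eq_zero]
  refine Correspondence.inner_definite (N := N) _ ?_
  rw [map_sub, h, sub_self]

theorem wTensor_ext {s t : wTensor N E F}
    (h : ∀ x y, Correspondence.inner (N := N) (wtmul N x y) s =
      Correspondence.inner (wtmul N x y) t) : s = t := by
  apply Subtype.ext
  ext1 k
  refine ext_inner_t3 N fun x y k' => ?_
  have h1 := congrArg (fun a : El N => ⟪k', (a : H →L[ℂ] H) k⟫_ℂ) (h x y)
  change ⟪k', ContinuousLinearMap.adjoint (wtmul N x y).1 (s.1 k)⟫_ℂ =
    ⟪k', ContinuousLinearMap.adjoint (wtmul N x y).1 (t.1 k)⟫_ℂ at h1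
  rwa [ContinuousLinearMap.adjoint_inner_right, ContinuousLinearMap.adjoint_inner_right] at h1

theorem CorrIso.ext_wtmul {u v : CorrIso N (wTensor N E F) G}
    (h : ∀ x y, u.toLinearEquiv (wtmul N x y) = v.toLinearEquiv (wtmul N x y)) : u = v := by
  have h1 : u.toLinearEquiv = v.toLinearEquiv := by
    ext1 t
    rw [← v.toLinearEquiv.symm_apply_eq]
    refine wTensor_ext (N := N) fun x y => ?_
    rw [← v.map_inner, LinearEquiv.apply_symm_apply, ← h, u.map_inner]
  cases u; cases v; cases h1; rfl

theorem AdjMap.ext_wtmul {m m' : AdjMap N (wTensor N E F) G}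
    (h : ∀ x y, m.map (wtmul N x y) = m'.map (wtmul N x y)) : m = m' := by
  have h1 : m.adj = m'.adj := by
    ext1 z
    refine wTensor_ext (N := N) fun x y => ?_
    rw [← m.map_inner, h, m'.map_inner]
  have h2 : m.map = m'.map := by
    ext1 t
    refine Correspondence.ext_inner_left (N := N) fun z => ?_
    rw [← Correspondence.star_inner (m.map t), ← Correspondence.star_inner (m'.map t),
      m.map_inner, m'.map_inner, h1]
  cases m; cases m'; cases h1; cases h2; rfl

/-- An isomorphism as an adjointable map; its adjoint is its inverse. -/
def CorrIso.toAdjMap (u : CorrIso N E F) : AdjMap N E F where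
  map := u.toLinearEquiv.toLinearMap
  adj := u.toLinearEquiv.symm.toLinearMap
  map_inner x y := by
    rw [← u.map_inner x]
    simp only [LinearEquiv.coe_coe, LinearEquiv.apply_symm_apply]

namespace AdjMap

/-- The adjoint, as an adjointable map. -/
def adjoint (m : AdjMap N E F) : AdjMap N F E where
  map := m.adj
  adj := m.map
  map_inner y x := by
    rw [← Correspondence.star_inner, ← m.map_inner, Correspondence.star_inner]

/-- The composition of adjointable maps. -/
def comp (m : AdjMap N F G) (n : AdjMap N E F) : AdjMap N E G where
  map := m.map ∘ₗ n.map
  adj := n.adj ∘ₗ m.adj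
  map_inner x y := by
    rw [LinearMap.comp_apply, m.map_inner, n.map_inner]; rfl

theorem inner_adj_adj (m : AdjMap N E F) (hm : ∀ y, m.map (m.adj y) = y) (y y' : F) :
    Correspondence.inner (N := N) (m.adj y) (m.adj y') = Correspondence.inner y y' := by
  rw [← m.map_inner, hm]

variable {A B C D : Type*} [AddCommGroup A] [Module ℂ A] [AddCommGroup B] [Module ℂ B]
  [AddCommGroup C] [Module ℂ C] [AddCommGroup D] [Module ℂ D] [Correspondence N A]
  [Correspondence N B] [Correspondence N C] [Correspondence N D]

/-- The adjointable map `u⁻¹ v* w t`, for isomorphisms `t`, `w`, `u` and an adjointable `v`. -/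
def compress (t : CorrIso N A B) (w : CorrIso N B C) (v : AdjMap N D C) (u : CorrIso N E D) :
    AdjMap N A E :=
  u.symm.toAdjMap.comp (v.adjoint.comp (w.toAdjMap.comp t.toAdjMap))

theorem apply_compress_map (t : CorrIso N A B) (w : CorrIso N B C) (v : AdjMap N D C)
    (u : CorrIso N E D) (a : A) : u.toLinearEquiv ((compress t w v u).map a) =
      v.adj (w.toLinearEquiv (t.toLinearEquiv a)) :=
  u.toLinearEquiv.apply_symm_apply _

theorem compress_map_adj (t : CorrIso N A B) (w : CorrIso N B C) {v : AdjMap N D C}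
    (u : CorrIso N E D) (hv : ∀ d, v.adj (v.map d) = d) (e : E) :
    (compress t w v u).map ((compress t w v u).adj e) = e := by
  change u.toLinearEquiv.symm (v.adj (w.toLinearEquiv (t.toLinearEquiv (t.toLinearEquiv.symm
    (w.toLinearEquiv.symm (v.map (u.toLinearEquiv e))))))) = e
  rw [LinearEquiv.apply_symm_apply, LinearEquiv.apply_symm_apply, hv,
    LinearEquiv.symm_apply_apply]

end AdjMap

end Maps

namespace NormalUCP

variable {H : Type*} [NormedAddCommGroup H] [InnerProductSpace ℂ H] [CompleteSpace H]
variable {M : VonNeumannAlgebra H} (P Q : NormalUCP M)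

/-! ### The operators `I ⊗ X` -/

section IdTensor

variable {K K' : Type*} [NormedAddCommGroup K] [InnerProductSpace ℂ K] [CompleteSpace K]
  [NormedAddCommGroup K'] [InnerProductSpace ℂ K'] [CompleteSpace K']

theorem adjoint_idTensor (ρ : BiRep M K) (ρ' : BiRep M K') (X : K →L[ℂ] K')
    (hX : Intertwines ρ ρ' X) : ContinuousLinearMap.adjoint (P.idTensor ρ ρ' X hX) =
      P.idTensor ρ' ρ (ContinuousLinearMap.adjoint X) hX.adjoint :=
  P.ext_elem _ fun T k => P.ext_inner_elem _ fun S h => by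
    rw [ContinuousLinearMap.adjoint_inner_right, idTensor_elem, idTensor_elem, inner_elem,
      inner_elem, ← hX.adjoint.apply, ContinuousLinearMap.adjoint_inner_right]

/-- The operator `k ↦ S ⊗ k`. -/
def elemL (ρ : BiRep M K) (S : El M) : K →L[ℂ] P.Dil ρ := (P.kernel ρ).creation S

theorem elemL_apply (ρ : BiRep M K) (S : El M) (k : K) : P.elemL ρ S k = P.elem ρ S k := rfl

end IdTensor

/-- The operator `I ⊗ X : M ⊗_Q H → M ⊗_Q M ⊗_P H`, for `X ∈ L_P`. -/
def idTensorLM (X : P.LM) : Q.Dil (stdRep M) →L[ℂ] Q.Dil (P.dil (stdRep M)) :=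
  Q.idTensor (stdRep M) (P.dil (stdRep M)) X.1 (BiRep.mem_intertwiners.1 X.2)

theorem idTensorLM_elem (X : P.LM) (S : El M) (h : H) :
    P.idTensorLM Q X (Q.elem (stdRep M) S h) = Q.elem (P.dil (stdRep M)) S (X.1 h) :=
  Q.idTensor_elem _ _ _ _ S h

theorem adjoint_idTensorLM_elem (X : P.LM) (S : El M) (k : P.Dil (stdRep M)) :
    ContinuousLinearMap.adjoint (P.idTensorLM Q X) (Q.elem (P.dil (stdRep M)) S k) =
      Q.elem (stdRep M) S (ContinuousLinearMap.adjoint X.1 k) := by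
  rw [idTensorLM, adjoint_idTensor, idTensor_elem]

theorem psiOp_eq (X : P.LM) (Y : Q.LM) : P.psiOp Q X Y = P.idTensorLM Q X ∘L Y.1 := rfl

theorem psiOp_add_left (X X' : P.LM) (Y : Q.LM) :
    P.psiOp Q (X + X') Y = P.psiOp Q X Y + P.psiOp Q X' Y := by
  rw [psiOp_eq, psiOp_eq, psiOp_eq, ← ContinuousLinearMap.add_comp]
  congr 1
  refine Q.ext_elem _ fun S h => ?_
  rw [_root_.add_apply, idTensorLM_elem, idTensorLM_elem, idTensorLM_elem, ← elem_add_right]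
  rfl

theorem psiOp_smul_left (c : ℂ) (X : P.LM) (Y : Q.LM) :
    P.psiOp Q (c • X) Y = c • P.psiOp Q X Y := by
  rw [psiOp_eq, psiOp_eq, ← ContinuousLinearMap.smul_comp]
  congr 1
  refine Q.ext_elem _ fun S h => ?_
  rw [_root_.smul_apply, idTensorLM_elem, idTensorLM_elem, ← elem_smul_right]
  rfl

theorem psiOp_mem (X : P.LM) (Y : Q.LM) : P.psiOp Q X Y ∈ (P.dil₂ Q).intertwiners :=
  (Q.idTensor_intertwines _ _ X.1 X.2).comp Y.2

/-! ### The isomorphism `Ψ` -/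

/-- The linear map `X ⊗ Y ↦ (I ⊗ X) Y` on the algebraic tensor product. -/
def psiLin : P.LM ⊗[ℂ] Q.LM →ₗ[ℂ] (H →L[ℂ] Q.Dil (P.dil (stdRep M))) :=
  TensorProduct.lift (LinearMap.mk₂ ℂ (P.psiOp Q) (P.psiOp_add_left Q) (P.psiOp_smul_left Q)
    (fun _ Y Y' => ContinuousLinearMap.comp_add _ Y.1 Y'.1)
    (fun c _ Y => ContinuousLinearMap.comp_smul _ c Y.1))

theorem inner_psiOp (X X' : P.LM) (Y Y' : Q.LM) (h h' : H) :
    ⟪P.psiOp Q X Y h, P.psiOp Q X' Y' h'⟫_ℂ =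
      ⟪t3 M.commutant X Y h, t3 M.commutant X' Y' h'⟫_ℂ := by
  have h1 : ContinuousLinearMap.adjoint (P.idTensorLM Q X) ∘L P.idTensorLM Q X' =
      (Q.dil (stdRep M)).right (Correspondence.inner (N := M.commutant) X X') :=
    Q.ext_elem _ fun S k => by
      rw [ContinuousLinearMap.comp_apply, idTensorLM_elem, adjoint_idTensorLM_elem,
        dil_right_elem]
      rfl
  rw [inner_t3, BiRep.inner_coe, ContinuousLinearMap.comp_apply,
    ContinuousLinearMap.adjoint_inner_right, BiRep.lact_coe, ← h1,
    ContinuousLinearMap.comp_apply, ContinuousLinearMap.comp_apply,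
    ContinuousLinearMap.adjoint_inner_right]
  rfl

theorem inner_psiLin (d d' : P.LM ⊗[ℂ] Q.LM) (h h' : H) :
    ⟪P.psiLin Q d h, P.psiLin Q d' h'⟫_ℂ =
      ⟪(tensorKernel M.commutant P.LM Q.LM).creation d h,
        (tensorKernel M.commutant P.LM Q.LM).creation d' h'⟫_ℂ := by
  induction d with
  | zero => simp
  | add a b ha hb => simp only [map_add, _root_.add_apply, inner_add_left, ha, hb]
  | tmul X Y =>
    induction d' with
    | zero => simp
    | add a b ha hb => simp only [map_add, _root_.add_apply, inner_add_right, ha, hb]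
    | tmul X' Y' => exact P.inner_psiOp Q X X' Y Y' h h'

/-- The linear map `X ⊗ Y ⊗ h ↦ (I ⊗ X) Y h` on the algebraic tensor product. -/
def thetaPre : (P.LM ⊗[ℂ] Q.LM) ⊗[ℂ] H →ₗ[ℂ] Q.Dil (P.dil (stdRep M)) :=
  TensorProduct.lift (LinearMap.mk₂ ℂ (fun d h => P.psiLin Q d h)
    (by intros; simp) (by intros; simp) (by intros; simp) (by intros; simp))

theorem inner_thetaPre (z z' : (P.LM ⊗[ℂ] Q.LM) ⊗[ℂ] H) :
    ⟪P.thetaPre Q z, P.thetaPre Q z'⟫_ℂ = ⟪(tensorKernel M.commutant P.LM Q.LM).of z,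
      (tensorKernel M.commutant P.LM Q.LM).of z'⟫_ℂ := by
  induction z with
  | zero => simp
  | add a b ha hb => simp only [map_add, inner_add_left, ha, hb]
  | tmul d h =>
    induction z' with
    | zero => simp
    | add a b ha hb => simp only [map_add, inner_add_right, ha, hb]
    | tmul d' h' => exact P.inner_psiLin Q d d' h h'

/-- The unitary `Θ : X ⊗ Y ⊗ h ↦ (I ⊗ X) Y h` from `L_P ⊗ L_Q ⊗ H` to `M ⊗_Q M ⊗_P H`, which
implements `Ψ`. -/
def theta : TensorSpace M.commutant P.LM Q.LM →L[ℂ] Q.Dil (P.dil (stdRep M)) :=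
  (tensorKernel M.commutant P.LM Q.LM).lift (P.thetaPre Q) ⟨1, fun z => by
    rw [one_mul, @norm_eq_sqrt_re_inner ℂ, inner_thetaPre, ← norm_eq_sqrt_re_inner]⟩

theorem theta_of (z : (P.LM ⊗[ℂ] Q.LM) ⊗[ℂ] H) :
    P.theta Q ((tensorKernel M.commutant P.LM Q.LM).of z) = P.thetaPre Q z :=
  PosKernel.lift_of _ _ _ _

theorem theta_t3 (X : P.LM) (Y : Q.LM) (h : H) :
    P.theta Q (t3 M.commutant X Y h) = P.psiOp Q X Y h :=
  P.theta_of Q _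

theorem theta_comp_creation (d : P.LM ⊗[ℂ] Q.LM) :
    P.theta Q ∘L (tensorKernel M.commutant P.LM Q.LM).creation d = P.psiLin Q d := by
  ext1 h
  exact P.theta_of Q _

theorem theta_comp_wtmul (X : P.LM) (Y : Q.LM) :
    P.theta Q ∘L (wtmul M.commutant X Y).1 = P.psiOp Q X Y :=
  P.theta_comp_creation Q (X ⊗ₜ Y)

theorem adjoint_theta_comp :
    ContinuousLinearMap.adjoint (P.theta Q) ∘L P.theta Q = ContinuousLinearMap.id ℂ _ :=
  ext_t3 _ fun X Y h => ext_inner_t3 _ fun X' Y' h' => by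
    rw [ContinuousLinearMap.comp_apply, ContinuousLinearMap.adjoint_inner_right, theta_t3,
      theta_t3, inner_psiOp]
    rfl

theorem range_psiLin_le : LinearMap.range (P.psiLin Q) ≤ (P.dil₂ Q).intertwiners := by
  rintro _ ⟨d, rfl⟩
  induction d with
  | zero => rw [map_zero]; exact Submodule.zero_mem _
  | add a b ha hb => rw [map_add]; exact Submodule.add_mem _ ha hb
  | tmul X Y => exact P.psiOp_mem Q X Y

theorem psiLin_comp (d : P.LM ⊗[ℂ] Q.LM) (R : El M.commutant) :
    P.psiLin Q d ∘L (R : H →L[ℂ] H) = P.psiLin Q (ractAlg M.commutant R d) := by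
  have h1 := congrArg (P.theta Q ∘L ·) (creation_comp M.commutant d R)
  rw [← P.theta_comp_creation Q d, ← P.theta_comp_creation Q (ractAlg M.commutant R d)]
  exact h1

/-- The vectors `(I ⊗ X) Y h` are total: the vectors `Y h` are total in `M ⊗_Q H`, so the closed
span contains `(I ⊗ X) (S ⊗ h) = S ⊗ X h`, and the vectors `X h` are total in `M ⊗_P H`. -/
theorem rangeSpan_psiLin : rangeSpan (LinearMap.range (P.psiLin Q)) = ⊤ := by
  have hcl : IsClosed (rangeSpan (LinearMap.range (P.psiLin Q)) :
      Set (Q.Dil (P.dil (stdRep M)))) := Submodule.isClosed_topologicalClosure _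
  have h1 : ∀ (X : P.LM) (w : Q.Dil (stdRep M)), P.idTensorLM Q X w ∈
      rangeSpan (LinearMap.range (P.psiLin Q)) := fun X =>
    map_mem_of_rangeSpan_eq_top Q.rangeSpan_intertwiners hcl _ fun Y hY h =>
      apply_mem_rangeSpan (X := P.psiOp Q X ⟨Y, hY⟩)
        (LinearMap.mem_range.2 ⟨X ⊗ₜ ⟨Y, hY⟩, rfl⟩) h
  have h2 : ∀ (S : El M) k, Q.elem (P.dil (stdRep M)) S k ∈
      rangeSpan (LinearMap.range (P.psiLin Q)) := fun S =>
    map_mem_of_rangeSpan_eq_top P.rangeSpan_intertwiners hcl (Q.elemL _ S) fun X hX h => by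
      rw [elemL_apply, ← P.idTensorLM_elem Q ⟨X, hX⟩]
      exact h1 ⟨X, hX⟩ _
  refine top_le_iff.1 fun x _ => ?_
  refine (Q.kernel (P.dil (stdRep M))).denseRange_of.induction_on
    (p := fun x => x ∈ rangeSpan (LinearMap.range (P.psiLin Q))) x hcl fun z => ?_
  induction z with
  | zero => rw [map_zero]; exact Submodule.zero_mem _
  | add a b ha hb => rw [map_add]; exact Submodule.add_mem _ ha hb
  | tmul S k => exact h2 S k

theorem theta_comp_adjoint :
    P.theta Q ∘L ContinuousLinearMap.adjoint (P.theta Q) = ContinuousLinearMap.id ℂ _ :=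
  comp_adjoint_of_rangeSpan_eq_top (P.rangeSpan_psiLin Q) (P.theta Q) (P.adjoint_theta_comp Q)
    (by rintro _ ⟨d, rfl⟩; exact ⟨_, P.theta_comp_creation Q d⟩)

theorem theta_comp_mem {T : H →L[ℂ] TensorSpace M.commutant P.LM Q.LM}
    (hT : T ∈ wTensor M.commutant P.LM Q.LM) : P.theta Q ∘L T ∈ (P.dil₂ Q).intertwiners := by
  refine mem_intertwiners_of_mem_closure (P.dil₂ Q)
    (s := Set.range fun d => (P.psiLin Q d : H → Q.Dil (P.dil (stdRep M)))) ?_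
    (comp_mem_closure (P.theta Q) ?_ ((mem_wTensor M.commutant).1 hT))
  · rintro _ ⟨d, rfl⟩ S h
    exact Intertwines.apply (ρ := stdRep M) (P.range_psiLin_le Q ⟨d, rfl⟩) S h
  · rintro _ ⟨d, rfl⟩
    exact ⟨d, congrArg DFunLike.coe (P.theta_comp_creation Q d).symm⟩

/-- Every `Z ∈ L_M(H, M ⊗_Q M ⊗_P H)` is a strong limit of operators `∑ (I ⊗ X) Y`, so `Θ* Z` is in
the `W*`-tensor product. -/
theorem adjoint_theta_comp_mem {Z : H →L[ℂ] Q.Dil (P.dil (stdRep M))}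
    (hZ : Z ∈ (P.dil₂ Q).intertwiners) :
    ContinuousLinearMap.adjoint (P.theta Q) ∘L Z ∈ wTensor M.commutant P.LM Q.LM := by
  have h1 := mem_closure_of_rangeSpan_eq_top (P.dil₂ Q) (P.range_psiLin_le Q)
    (by rintro _ ⟨d, rfl⟩ R; exact ⟨_, (P.psiLin_comp Q d R).symm⟩) (P.rangeSpan_psiLin Q) hZ
  rw [mem_wTensor]
  refine comp_mem_closure (ContinuousLinearMap.adjoint (P.theta Q)) ?_ h1
  rintro _ ⟨⟨_, d, rfl⟩, rfl⟩
  have h2 : (tensorKernel M.commutant P.LM Q.LM).creation d =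
      ContinuousLinearMap.adjoint (P.theta Q) ∘L P.psiLin Q d :=
    (comp_comp_of_comp_eq_id (P.adjoint_theta_comp Q) _).symm.trans
      (congrArg (ContinuousLinearMap.adjoint (P.theta Q) ∘L ·) (P.theta_comp_creation Q d))
  exact ⟨d, congrArg DFunLike.coe h2⟩

theorem theta_comp_tensorLeft (R : El M.commutant) :
    P.theta Q ∘L tensorLeft M.commutant P.LM Q.LM R = (P.dil₂ Q).right R ∘L P.theta Q :=
  ext_t3 _ fun X Y h => by
    change P.theta Q (tensorLeftMul M.commutant R (t3 M.commutant X Y h)) =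
      (P.dil₂ Q).right R (P.theta Q (t3 M.commutant X Y h))
    rw [tensorLeftMul_t3, theta_t3, theta_t3]
    have h1 : P.idTensorLM Q (Correspondence.lact R X) =
        (P.dil₂ Q).right R ∘L P.idTensorLM Q X := Q.ext_elem _ fun S k => by
      rw [ContinuousLinearMap.comp_apply, idTensorLM_elem, idTensorLM_elem, dil_right_elem]
      rfl
    exact congrArg (fun T => T (Y.1 h)) h1

/-- The isomorphism `Ψ : L_P ⊗ L_Q → L_M(H, M ⊗_Q M ⊗_P H)`, `X ⊗ Y ↦ (I ⊗ X) Y`. -/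
def psi : CorrIso M.commutant (wTensor M.commutant P.LM Q.LM) (P.LM₂ Q) where
  toFun T := ⟨P.theta Q ∘L T.1, P.theta_comp_mem Q T.2⟩
  invFun Z := ⟨ContinuousLinearMap.adjoint (P.theta Q) ∘L Z.1, P.adjoint_theta_comp_mem Q Z.2⟩
  map_add' S T := Subtype.ext (ContinuousLinearMap.comp_add _ S.1 T.1)
  map_smul' c T := Subtype.ext (ContinuousLinearMap.comp_smul _ c T.1)
  left_inv T := Subtype.ext (comp_comp_of_comp_eq_id (P.adjoint_theta_comp Q) T.1)
  right_inv Z := Subtype.ext (comp_comp_of_comp_eq_id (P.theta_comp_adjoint Q) Z.1)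
  map_lact R T := Subtype.ext (congrArg (· ∘L T.1) (P.theta_comp_tensorLeft Q R))
  map_ract _ _ := rfl
  map_inner S T := Subtype.ext (adjoint_comp_comp_of_isometry (P.adjoint_theta_comp Q) S.1 T.1)

/-! ### The isometry `V` -/

theorem adjoint_V₀_comp :
    ContinuousLinearMap.adjoint (P.V₀ Q) ∘L P.V₀ Q = ContinuousLinearMap.id ℂ _ :=
  ext_elem _ _ fun S h => ext_inner_elem _ _ fun T k => by
    rw [ContinuousLinearMap.comp_apply, ContinuousLinearMap.adjoint_inner_right, V₀_elem, V₀_elem,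
      ContinuousLinearMap.id_apply, inner_elem, inner_elem, dil_left_elem, inner_elem, star_one,
      one_mul, mul_one]
    rfl

theorem V_adj_map (X : (P.comp Q).LM) : (P.V Q).adj ((P.V Q).map X) = X :=
  Subtype.ext (comp_comp_of_comp_eq_id (P.adjoint_V₀_comp Q) X.1)

theorem V₀_mem_midI (x : (P.comp Q).Dil (stdRep M)) : P.V₀ Q x ∈ P.midI Q := by
  refine ((P.comp Q).kernel (stdRep M)).denseRange_of.induction_on
    (p := fun x => P.V₀ Q x ∈ P.midI Q) x
    ((Submodule.isClosed_topologicalClosure _).preimage (P.V₀ Q).continuous) fun z => ?_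
  induction z with
  | zero => rw [map_zero, map_zero]; exact Submodule.zero_mem _
  | add a b ha hb => rw [map_add, map_add]; exact Submodule.add_mem _ ha hb
  | tmul S h =>
    change P.V₀ Q ((P.comp Q).elem (stdRep M) S h) ∈ P.midI Q
    rw [V₀_elem]
    exact subset_closure (Submodule.subset_span ⟨(S, h), rfl⟩)

theorem V₀_adjoint_apply_of_mem_midI {y : Q.Dil (P.dil (stdRep M))} (hy : y ∈ P.midI Q) :
    P.V₀ Q (ContinuousLinearMap.adjoint (P.V₀ Q) y) = y := by
  have h1 : P.midI Q ≤ LinearMap.eqLocus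
      (P.V₀ Q ∘L ContinuousLinearMap.adjoint (P.V₀ Q)).toLinearMap LinearMap.id := by
    refine Submodule.topologicalClosure_minimal _ (Submodule.span_le.2 ?_)
      (isClosed_eq (ContinuousLinearMap.continuous _) continuous_id)
    rintro _ ⟨⟨S, h⟩, rfl⟩
    change P.V₀ Q (ContinuousLinearMap.adjoint (P.V₀ Q)
      (Q.elem (P.dil (stdRep M)) S (P.elem (stdRep M) 1 h))) =
      Q.elem (P.dil (stdRep M)) S (P.elem (stdRep M) 1 h)
    rw [← P.V₀_elem Q]
    exact congrArg (fun T => P.V₀ Q (T ((P.comp Q).elem (stdRep M) S h))) (P.adjoint_V₀_comp Q)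
  exact h1 hy

theorem range_V_map :
    Set.range (P.V Q).map = {Z : P.LM₂ Q | ∀ h : H, Z.1 h ∈ P.midI Q} := by
  ext Z
  constructor
  · rintro ⟨X, rfl⟩ h
    exact P.V₀_mem_midI Q (X.1 h)
  · intro hZ
    refine ⟨(P.V Q).adj Z, Subtype.ext ?_⟩
    ext1 h
    exact P.V₀_adjoint_apply_of_mem_midI Q (hZ h)

/-! ### The multiplication map -/

/-- The multiplication map `m = U_{PQ}⁻¹ V* Ψ (U_P ⊗ U_Q)`. -/
def mulMap : AdjMap M.commutant (wTensor M.commutant P.arveson Q.arveson) (P.comp Q).arveson :=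
  AdjMap.compress (CorrIso.tensor P.U Q.U) (P.psi Q) (P.V Q) (P.comp Q).U

theorem mulMap_map_adj (e : (P.comp Q).arveson) : (P.mulMap Q).map ((P.mulMap Q).adj e) = e :=
  AdjMap.compress_map_adj _ _ _ (P.V_adj_map Q) e

/-- The adjoint of `W_{PQ}* V₀* (I ⊗ Φ_Y*) Φ_Z*` maps `h` to
`Φ_Z (I ⊗ Φ_Y) (I ⊗ I ⊗ h) = Z* Y* h`. -/
theorem adjoint_W_V₀_psiOp (Y : P.arveson) (Z : Q.arveson) :
    ContinuousLinearMap.adjoint (P.comp Q).W ∘L (ContinuousLinearMap.adjoint (P.V₀ Q) ∘L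
      P.psiOp Q (P.ULin Y) (Q.ULin Z)) = Y.1 ∘L Z.1 := by
  rw [psiOp_eq, ULin_coe, ← ContinuousLinearMap.adjoint_adjoint (Y.1 ∘L Z.1),
    ← ContinuousLinearMap.adjoint_adjoint (P.idTensorLM Q (P.ULin Y)),
    ← ContinuousLinearMap.adjoint_comp, ← ContinuousLinearMap.adjoint_comp,
    ← ContinuousLinearMap.adjoint_comp]
  congr 1
  ext1 h
  have h1 : ContinuousLinearMap.adjoint (P.ULin Y).1 = P.Phi Y :=
    ContinuousLinearMap.adjoint_adjoint _
  rw [ContinuousLinearMap.comp_apply, ContinuousLinearMap.comp_apply,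
    ContinuousLinearMap.comp_apply, W_apply, V₀_elem, adjoint_idTensorLM_elem, h1, Phi_elem,
    Phi_elem, ContinuousLinearMap.adjoint_comp]
  rfl

theorem mulMap_wtmul (Y : P.arveson) (Z : Q.arveson) :
    ((P.mulMap Q).map (wtmul M.commutant Y Z)).1 = Y.1 ∘L Z.1 := by
  have h1 : ((P.psi Q).toLinearEquiv ((CorrIso.tensor P.U Q.U).toLinearEquiv
      (wtmul M.commutant Y Z))).1 = P.psiOp Q (P.ULin Y) (Q.ULin Z) :=
    (congrArg (fun t => ((P.psi Q).toLinearEquiv t).1) (CorrIso.tensor_wtmul P.U Q.U Y Z)).trans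
      (P.theta_comp_wtmul Q _ _)
  have h2 := (LinearEquiv.eq_symm_apply (P.comp Q).ULin).2
    (AdjMap.apply_compress_map (CorrIso.tensor P.U Q.U) (P.psi Q) (P.V Q) (P.comp Q).U
      (wtmul M.commutant Y Z))
  refine (congrArg Subtype.val h2).trans (Eq.trans ?_ (P.adjoint_W_V₀_psiOp Q Y Z))
  exact congrArg (fun T => ContinuousLinearMap.adjoint (P.comp Q).W ∘L
    (ContinuousLinearMap.adjoint (P.V₀ Q) ∘L T)) h1

theorem eq_mulMap
    {m : AdjMap M.commutant (wTensor M.commutant P.arveson Q.arveson) (P.comp Q).arveson}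
    (hm : ∀ (Y : P.arveson) (Z : Q.arveson),
      (m.map (wtmul M.commutant Y Z)).1 = Y.1 ∘L Z.1) : m = P.mulMap Q :=
  AdjMap.ext_wtmul fun Y Z => Subtype.ext ((hm Y Z).trans (P.mulMap_wtmul Q Y Z).symm)

end NormalUCP

end ArvesonCorr

end

theorem proposition1p9 {H : Type*} [NormedAddCommGroup H] [InnerProductSpace ℂ H]
    [CompleteSpace H] (M : VonNeumannAlgebra H) (P Q : NormalUCP M) :
    -- `Ψ` is a well defined isomorphism of correspondences
    (∃! Ψ : CorrIso M.commutant (wTensor M.commutant P.LM Q.LM) (P.LM₂ Q),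
      ∀ (X : P.LM) (Y : Q.LM),
        (Ψ.toLinearEquiv (wtmul M.commutant X Y)).1 = P.psiOp Q X Y) ∧
    -- `V` is an isometry
    (∀ X X' : (P.comp Q).LM,
      Correspondence.inner (N := M.commutant) ((P.V Q).map X) ((P.V Q).map X') =
        Correspondence.inner (N := M.commutant) X X') ∧
    -- the range of `V`
    Set.range (P.V Q).map = {Z : P.LM₂ Q | ∀ h : H, Z.1 h ∈ P.midI Q} ∧
    -- the multiplication map `m` is a well defined adjointable map
    (∃! m : AdjMap M.commutant (wTensor M.commutant P.arveson Q.arveson) (P.comp Q).arveson,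
      ∀ (Y : P.arveson) (Z : Q.arveson), (m.map (wtmul M.commutant Y Z)).1 = Y.1 ∘L Z.1) ∧
    ∀ (Ψ : CorrIso M.commutant (wTensor M.commutant P.LM Q.LM) (P.LM₂ Q))
      (m : AdjMap M.commutant (wTensor M.commutant P.arveson Q.arveson) (P.comp Q).arveson),
      (∀ (X : P.LM) (Y : Q.LM),
        (Ψ.toLinearEquiv (wtmul M.commutant X Y)).1 = P.psiOp Q X Y) →
      (∀ (Y : P.arveson) (Z : Q.arveson),
        (m.map (wtmul M.commutant Y Z)).1 = Y.1 ∘L Z.1) →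
      -- `U_{PQ} m (U_P⁻¹ ⊗ U_Q⁻¹) = V* Ψ`
      (∀ t : wTensor M.commutant P.LM Q.LM,
        (P.comp Q).U.toLinearEquiv
            (m.map ((CorrIso.tensor P.U.symm Q.U.symm).toLinearEquiv t)) =
          (P.V Q).adj (Ψ.toLinearEquiv t)) ∧
      -- `m` is coisometric
      (∀ e : (P.comp Q).arveson, m.map (m.adj e) = e) ∧
      -- `m*` is isometric
      (∀ e e' : (P.comp Q).arveson,
        Correspondence.inner (N := M.commutant) (m.adj e) (m.adj e') =
          Correspondence.inner (N := M.commutant) e e') := by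
  have heq : ∀ Ψ : CorrIso M.commutant (wTensor M.commutant P.LM Q.LM) (P.LM₂ Q),
      (∀ (X : P.LM) (Y : Q.LM),
        (Ψ.toLinearEquiv (wtmul M.commutant X Y)).1 = P.psiOp Q X Y) → Ψ = P.psi Q :=
    fun Ψ hΨ => CorrIso.ext_wtmul fun X Y =>
      Subtype.ext ((hΨ X Y).trans (P.theta_comp_wtmul Q X Y).symm)
  refine ⟨⟨P.psi Q, P.theta_comp_wtmul Q, fun Ψ hΨ => ?_⟩, fun X X' => ?_, P.range_V_map Q,
    ⟨P.mulMap Q, P.mulMap_wtmul Q, fun m hm => ?_⟩, fun Ψ m hΨ hm => ?_⟩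
  · exact heq Ψ hΨ
  · rw [(P.V Q).map_inner, P.V_adj_map Q]
  · exact P.eq_mulMap Q hm
  · have hΨ' := heq Ψ hΨ
    have hm' := P.eq_mulMap Q hm
    subst hΨ' hm'
    refine ⟨fun t => ?_, P.mulMap_map_adj Q,
      (P.mulMap Q).inner_adj_adj (P.mulMap_map_adj Q)⟩
    -- by definition, `U_P⁻¹ ⊗ U_Q⁻¹` is the inverse of `U_P ⊗ U_Q`
    have h : (CorrIso.tensor P.U Q.U).toLinearEquiv
        ((CorrIso.tensor P.U.symm Q.U.symm).toLinearEquiv t) = t :=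
      (CorrIso.tensor P.U Q.U).toLinearEquiv.apply_symm_apply t
    exact (AdjMap.apply_compress_map (CorrIso.tensor P.U Q.U) (P.psi Q) (P.V Q) (P.comp Q).U
      _).trans (congrArg (fun t => (P.V Q).adj ((P.psi Q).toLinearEquiv t)) h)
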